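/- **Setting.** Let $n\ge 1$, $a\ge 0$, $d\ge 0$. A depth-$d$ $\mathbf{QAC}$ circuit on $n+a$ qubits is a unitary $U=L_dM_d\cdots L_1M_1L_0$, where each $L_i$ is a tensor product of arbitrary single-qubit unitaries and each $M_i$ is a tensor product of generalized $CZ$ gates $\mathrm{id}-2|1\cdots1\rangle\langle1\cdots1|$ acting on pairwise disjoint nonempty sets of qubits (of any size; qubits may be left untouched). The first $n$ qubits are the input and the last $a$ qubits are ancillae, initialized in an arbitrary density operator $\varphi$ on $a$ qubits. On input $x\in\{0,1\}^n$ the output $C_U(x)\in\{0,1\}$ is the result of measuring the first qubit in the computational basis, that is, $\Pr[C_U(x)=b]=\mathrm{Tr}\big[(|b\rangle\langle b|\otimes \mathrm{id})\,U(|x\rangle\langle x|\otimes\varphi)U^\dagger\big]$. For $f:\{0,1\}^n\to\{0,1\}$, regarded as real-valued, put $\hat f(S)=2^{-n}\sum_x f(x)(-1)^{\sum_{i\in S}x_i}$ for $S\subseteq\{1,\dots,n\}$ and $W^{>k}[f]=\sum_{|S|>k}\hat f(S)^2$. Below, $x$ is uniform in $\{0,1\}^n$, and probabilities are over both $x$ and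 the measurement. **Theorem.** 1. There are absolute constants $C,K>0$ and $\gamma\in\mathbb N$ such that for all $d\ge 0$, $n\ge1$, $a\ge 0$, every depth-$d$ $\mathbf{QAC}$ circuit $U$ on $n+a$ qubits, every ancilla state $\varphi$, every $f:\{0,1\}^n\to\{0,1\}$, and every integer $k\ge C\,(n+a)^{1-3^{-d}}\,(\log(n+a+1))^{\gamma}$, $$\Pr[C_U(x)=f(x)]\le \frac12+\frac12\sqrt{1-4W^{>k}[f]}+K\cdot\frac dn .$$ 2. There is an absolute constant $K>0$ such that for every fixed depth $d\ge0$ and all $B\in\mathbb R$, $\beta\in\mathbb N$ there is $n_0$ such that for all $n\ge \max(n_0,1)$, all $a\le B\,n^{1+3^{-d}}(\log n)^\beta$, every depth-$d$ $\mathbf{QAC}$ circuit $U$ on $n+a$ qubits and every ancilla state $\varphi$, $$\Pr[C_U(x)=\mathrm{PARITY}_n(x)]\le \frac12+K\cdot\frac dn ,$$ where $\mathrm{PARITY}_n(x)=\bigoplus_i x_i$. 3. There are absolute constants $\kappa,K>0$ such that for every fixed depth $d\ge0$ and all $B\in\mathbb R$, $\beta\in\mathbb N$ there is $n_0$ such that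 for all odd $n\ge n_0$, all $a\le B\,n^{1+3^{-d}}(\log n)^\beta$, every depth-$d$ $\mathbf{QAC}$ circuit $U$ on $n+a$ qubits and every ancilla state $\varphi$, $$\Pr[C_U(x)=\mathrm{MAJORITY}_n(x)]\le 1-\frac{\kappa}{\sqrt n}+K\cdot\frac dn ,$$ where $\mathrm{MAJORITY}_n(x)=1$ if $\sum_i x_i\ge n/2$ and $0$ otherwise. -/

import Mathlib

namespace QAC

open scoped Kronecker ComplexOrder

/-- Bit strings of length `n`; they also label the computational basis of `n` qubits. -/
abbrev Bits (n : ℕ) : Type := Fin n → Bool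

/-- Operators on `m` qubits, written in the computational basis. -/
abbrev Op (m : ℕ) : Type := Matrix (Bits m) (Bits m) ℂ

/-! ### Circuits -/

/-- The tensor product `u 0 ⊗ u 1 ⊗ ⋯ ⊗ u (m - 1)` of single-qubit unitaries. -/
def singleQubitLayer {m : ℕ} (u : Fin m → Matrix.unitaryGroup Bool ℂ) : Op m :=
  Matrix.of fun y z => ∏ i, (u i : Matrix Bool Bool ℂ) (y i) (z i)

/-- The orthogonal projection `|1⋯1⟩⟨1⋯1| ⊗ id`, where the first factor lives on the qubits
in `S` and the identity on all the other qubits. -/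
def allOnesProj {m : ℕ} (S : Finset (Fin m)) : Op m :=
  Matrix.diagonal fun y => if ∀ i ∈ S, y i = true then 1 else 0

/-- The generalized `CZ` gate `id - 2 |1⋯1⟩⟨1⋯1|` on the qubits in `S`, extended by the identity
to all `m` qubits. -/
noncomputable def cz {m : ℕ} (S : Finset (Fin m)) : Op m :=
  1 - (2 : ℂ) • allOnesProj S

/-- A layer of generalized `CZ` gates that act on pairwise disjoint sets of qubits
(a qubit may be left untouched). -/
structure CZLayer (m : ℕ) where
  gates : List (Finset (Fin m))
  nonempty : ∀ S ∈ gates, S.Nonempty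
  disjoint : gates.Pairwise Disjoint

/-- The tensor product of the gates of the layer. -/
noncomputable def CZLayer.toOp {m : ℕ} (M : CZLayer m) : Op m :=
  (M.gates.map cz).prod

/-- `Circuit m d` is the type of circuits `L_d M_d ⋯ L_1 M_1 L_0` of depth `d` on `m` qubits, where
each `L_i` is a tensor product of single-qubit unitaries and each `M_i` is a tensor product
of generalized `CZ` gates. -/
inductive Circuit (m : ℕ) : ℕ → Type
  | init (L : Fin m → Matrix.unitaryGroup Bool ℂ) : Circuit m 0
  | step {d : ℕ} (U : Circuit m d) (M : CZLayer m)
      (L : Fin m → Matrix.unitaryGroup Bool ℂ) : Circuit m (d + 1)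

/-- The unitary operator that a circuit implements. -/
noncomputable def Circuit.toOp {m : ℕ} : {d : ℕ} → Circuit m d → Op m
  | _, .init L => singleQubitLayer L
  | _, .step U M L => singleQubitLayer L * M.toOp * U.toOp

/-- Density operators on `a` qubits. -/
structure IsDensityOperator {a : ℕ} (φ : Op a) : Prop where
  posSemidef : φ.PosSemidef
  trace_eq_one : φ.trace = 1

/-- The state `|x⟩⟨x| ⊗ φ` of `n` input qubits, followed by `a` ancilla qubits. -/
def initialState {n a : ℕ} (x : Bits n) (φ : Op a) : Op (n + a) :=
  Matrix.reindex (Fin.appendEquiv n a) (Fin.appendEquiv n a)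
    ((Matrix.single x x (1 : ℂ) : Op n) ⊗ₖ φ)

/-- The measurement operator `|b⟩⟨b| ⊗ id` on the first of `m` qubits. -/
def measureFirst {m : ℕ} (hm : 0 < m) (b : Bool) : Op m :=
  Matrix.diagonal fun y => if y ⟨0, hm⟩ = b then 1 else 0

/-- The probability `Tr[(|b⟩⟨b| ⊗ id) U (|x⟩⟨x| ⊗ φ) U†]` that measuring the first qubit after
running `U` on the input `x`, with ancillae in the state `φ`, gives `b`. -/
noncomputable def outputProb {n a d : ℕ} (hn : 0 < n) (U : Circuit (n + a) d) (φ : Op a)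
    (x : Bits n) (b : Bool) : ℝ :=
  (measureFirst (Nat.add_pos_left hn a) b *
    (U.toOp * initialState x φ * U.toOp.conjTranspose)).trace.re

/-- The probability that the output of the circuit equals `f x` when `x` is uniformly random. -/
noncomputable def successProb {n a d : ℕ} (hn : 0 < n) (U : Circuit (n + a) d) (φ : Op a)
    (f : Bits n → Bool) : ℝ :=
  (∑ x : Bits n, outputProb hn U φ x (f x)) / 2 ^ n

/-! ### Boolean functions -/

/-- The character `χ_S(x) = (-1) ^ ∑_{i ∈ S} x_i`. -/
def character {n : ℕ} (S : Finset (Fin n)) (x : Bits n) : ℝ :=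
  (-1) ^ ∑ i ∈ S, (x i).toNat

/-- The Fourier coefficient `E_x[f(x) χ_S(x)]`. -/
noncomputable def fourierCoeff {n : ℕ} (f : Bits n → ℝ) (S : Finset (Fin n)) : ℝ :=
  (∑ x : Bits n, f x * character S x) / 2 ^ n

/-- The Fourier weight of `f` above level `k`. -/
noncomputable def weightAbove {n : ℕ} (k : ℕ) (f : Bits n → ℝ) : ℝ :=
  ∑ S : Finset (Fin n) with k < S.card, fourierCoeff f S ^ 2

/-- A `{0,1}`-valued function as a real-valued function. -/
def toReal {n : ℕ} (f : Bits n → Bool) (x : Bits n) : ℝ := if f x then 1 else 0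

/-- The Hamming weight. -/
def hammingWeight {n : ℕ} (x : Bits n) : ℕ := ∑ i, (x i).toNat

/-- The parity of the bits. -/
def parity (n : ℕ) (x : Bits n) : Bool := decide (hammingWeight x % 2 = 1)

/-- The majority function (to be used for odd `n`): `1` iff the Hamming weight is at
least `n / 2`. -/
def majority (n : ℕ) (x : Bits n) : Bool := decide (n ≤ 2 * hammingWeight x)

end QAC

namespace QAC

open scoped Kronecker ComplexOrder Matrix

/-! The argument is a low-degree approximation in the Heisenberg picture. Write m = n + a.
Conjugating the observable Z on the first qubit by the circuit gives an operator A whose expectation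
on |x⟩⟨x| ⊗ φ is Pr[0] − Pr[1]. Call an operator of degree k if it is a sum of operators acting on
at most k qubits each. The claim is that A is within 4d/m, in operator norm, of an operator of
degree about m^(1 − 3^(−d)), up to logarithms.

One layer of gates is treated with a threshold σ. Gates on at most σ qubits multiply the degree by
at most σ, exactly, by a light-cone argument (`czProd_conj_mem_degLE`). A gate on s > σ qubits is a
function of the number of ones on its qubits, and a Chebyshev polynomial of degree about √s
approximates it (`exists_polynomial_peak`); since the gates are disjoint, these degrees add up to at
most about m/√σ. Thus D becomes σD + m/√σ up to logarithms, and balancing the two terms gives D'/m ≈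
(D/m)^(1/3) (`ApproxDeg.czProd_conj_circuitDegree`). Every factor has norm at most 1, so errors add
over the layers.

An observable of degree k has expectation values, as a function of x, with Fourier support on levels
at most k (`sum_trace_mul_character`). Cauchy–Schwarz then bounds the correlation with (−1)^f by the
square root of the low-level weight of (−1)^f, which is 1 − 4W^{>k}[f] (`correlation_le`). This is
the first bound.

For a of order n^(1 + 3^(−d)) up to logarithms the degree is still o(n), because (1 + t)(1 − t) < 1.
Parity lives on level n alone. For majority, the first two moments of the level distribution force
weight of order 1/√n above level n/4. -/

/-! ### Tensor products of single-qubit operators -/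

/-- The tensor product of single-qubit operators. -/
def tensor (m : ℕ) : (Fin m → Matrix Bool Bool ℂ) →* Op m where
  toFun u := Matrix.of fun y z => ∏ i, u i (y i) (z i)
  map_one' := by
    ext y z
    simp only [Matrix.of_apply, Pi.one_apply, Matrix.one_apply]
    by_cases h : y = z
    · simp [h]
    · obtain ⟨i, hi⟩ := Function.ne_iff.1 h
      rw [if_neg h]
      exact Finset.prod_eq_zero (Finset.mem_univ i) (if_neg hi)
  map_mul' u v := by
    ext y z
    simp only [Matrix.of_apply, Pi.mul_apply, Matrix.mul_apply, ← Finset.prod_mul_distrib]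
    rw [Finset.prod_univ_sum, Fintype.piFinset_univ]

theorem tensor_apply {m : ℕ} (u : Fin m → Matrix Bool Bool ℂ) (y z : Bits m) :
    tensor m u y z = ∏ i, u i (y i) (z i) := rfl

/-- The operator `u` on the qubit `i`. -/
def site {m : ℕ} (i : Fin m) (u : Matrix Bool Bool ℂ) : Op m := tensor m (Pi.mulSingle i u)

/-- The projection `|1⟩⟨1|` of one qubit. -/
def oneProj : Matrix Bool Bool ℂ := Matrix.diagonal fun b => if b then 1 else 0

theorem site_commute {m : ℕ} {i j : Fin m} (h : i ≠ j) (u v : Matrix Bool Bool ℂ) :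
    Commute (site i u) (site j v) := by
  have hc : Commute (Pi.mulSingle i u : Fin m → Matrix Bool Bool ℂ) (Pi.mulSingle j v) :=
    Pi.mulSingle_commute (f := fun _ => Matrix Bool Bool ℂ) h u v
  rw [site, site, commute_iff_eq, ← map_mul, ← map_mul, hc.eq]

theorem site_oneProj {m : ℕ} (i : Fin m) :
    site i oneProj = Matrix.diagonal fun y : Bits m => if y i then (1 : ℂ) else 0 := by
  ext y z
  rw [site, tensor_apply, Matrix.diagonal_apply,
    Finset.prod_eq_mul_prod_sdiff_singleton_of_mem (Finset.mem_univ i)]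
  have hrest : ∏ j ∈ Finset.univ \ {i}, (Pi.mulSingle i oneProj : Fin m → Matrix Bool Bool ℂ) j
      (y j) (z j) = if ∀ j, j ≠ i → y j = z j then 1 else 0 := by
    split_ifs with h
    · refine Finset.prod_eq_one fun j hj => ?_
      have hj : j ≠ i := by simpa using hj
      simp [Pi.mulSingle_eq_of_ne hj, h j hj]
    · push Not at h
      obtain ⟨j, hj, hne⟩ := h
      refine Finset.prod_eq_zero (i := j) (by simp [hj]) ?_
      simp [Pi.mulSingle_eq_of_ne hj, hne]
  rw [hrest]
  simp only [Pi.mulSingle_eq_same, oneProj, Matrix.diagonal_apply]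
  by_cases hyz : y = z
  · simp [hyz]
  · by_cases hi : y i = z i
    · have : ¬ ∀ j, j ≠ i → y j = z j := fun h => hyz (funext fun j => by
        by_cases hj : j = i
        · rw [hj, hi]
        · exact h j hj)
      simp [this, hyz]
    · simp [hi, hyz]

/-! ### Local operators -/

/-- The operators that act only on the qubits in `T`. -/
def localOps {m : ℕ} (T : Finset (Fin m)) : Subalgebra ℂ (Op m) :=
  Subalgebra.centralizer ℂ {B | ∃ i ∉ T, ∃ u, B = site i u}

/-- Locality is a commutation condition, so it can be transported through conjugations
algebraically, without choosing a tensor factorization. -/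
theorem mem_localOps {m : ℕ} {T : Finset (Fin m)} {A : Op m} :
    A ∈ localOps T ↔ ∀ i ∉ T, ∀ u, Commute (site i u) A := by
  simp only [localOps, Subalgebra.mem_centralizer_iff, Set.mem_ofPred_eq]
  exact ⟨fun h i hi u => h _ ⟨i, hi, u, rfl⟩, by rintro h _ ⟨i, hi, u, rfl⟩; exact h i hi u⟩

theorem localOps_mono {m : ℕ} {T T' : Finset (Fin m)} (h : T ⊆ T') :
    localOps T ≤ localOps T' := fun _ hA =>
  mem_localOps.2 fun i hi u => mem_localOps.1 hA i (fun hT => hi (h hT)) u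

theorem mem_localOps_univ {m : ℕ} (A : Op m) : A ∈ localOps Finset.univ :=
  mem_localOps.2 fun i hi => absurd (Finset.mem_univ i) hi

theorem site_mem_localOps {m : ℕ} (i : Fin m) (u : Matrix Bool Bool ℂ) :
    site i u ∈ localOps {i} :=
  mem_localOps.2 fun j hj v => site_commute (by simpa using hj) v u

theorem allOnesProj_insert {m : ℕ} (i : Fin m) (S : Finset (Fin m)) :
    allOnesProj (insert i S) = site i oneProj * allOnesProj S := by
  rw [site_oneProj, allOnesProj, allOnesProj, Matrix.diagonal_mul_diagonal]
  congr 1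
  funext y
  by_cases h : y i <;> simp [h]

theorem allOnesProj_empty {m : ℕ} : allOnesProj (∅ : Finset (Fin m)) = 1 := by
  simp [allOnesProj]

theorem allOnesProj_mem_localOps {m : ℕ} (S : Finset (Fin m)) : allOnesProj S ∈ localOps S := by
  induction S using Finset.induction_on with
  | empty => rw [allOnesProj_empty]; exact one_mem _
  | insert i S _ ih =>
    rw [allOnesProj_insert]
    exact mul_mem (localOps_mono (by simp) (site_mem_localOps i _))
      (localOps_mono (Finset.subset_insert i S) ih)

theorem allOnesProj_commute {m : ℕ} {S T : Finset (Fin m)} (h : Disjoint S T) {A : Op m}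
    (hA : A ∈ localOps T) : Commute (allOnesProj S) A := by
  induction S using Finset.induction_on with
  | empty => rw [allOnesProj_empty]; exact Commute.one_left A
  | insert i S _ ih =>
    rw [Finset.disjoint_insert_left] at h
    rw [allOnesProj_insert]
    exact (mem_localOps.1 hA i h.1 _).mul_left (ih h.2)

theorem cz_mem_localOps {m : ℕ} (S : Finset (Fin m)) : cz S ∈ localOps S :=
  sub_mem (one_mem _) (Subalgebra.smul_mem _ (allOnesProj_mem_localOps S) _)

theorem cz_commute {m : ℕ} {S T : Finset (Fin m)} (h : Disjoint S T) {A : Op m}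
    (hA : A ∈ localOps T) : Commute (cz S) A :=
  (Commute.one_left A).sub_left ((allOnesProj_commute h hA).smul_left _)

/-! ### Operators of bounded degree -/

/-- The operators of degree at most `k`: sums of operators that act on at most `k` qubits. -/
def degLE (m k : ℕ) : Submodule ℂ (Op m) :=
  Submodule.span ℂ {A | ∃ T : Finset (Fin m), T.card ≤ k ∧ A ∈ localOps T}

theorem mem_degLE_of_mem_localOps {m k : ℕ} {T : Finset (Fin m)} (hT : T.card ≤ k) {A : Op m}
    (hA : A ∈ localOps T) : A ∈ degLE m k := Submodule.subset_span ⟨T, hT, hA⟩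

theorem degLE_mono {m j k : ℕ} (h : j ≤ k) : degLE m j ≤ degLE m k :=
  Submodule.span_mono fun _ ⟨T, hT, hA⟩ => ⟨T, hT.trans h, hA⟩

theorem mem_degLE_self {m : ℕ} (A : Op m) : A ∈ degLE m m :=
  mem_degLE_of_mem_localOps (T := Finset.univ) (by simp) (mem_localOps_univ A)

theorem one_mem_degLE (m k : ℕ) : (1 : Op m) ∈ degLE m k :=
  mem_degLE_of_mem_localOps (T := ∅) (by simp) (one_mem _)

/-- Supports T and T' of two local factors combine into T ∪ T'. -/
theorem mul_mem_degLE {m j k : ℕ} {A B : Op m} (hA : A ∈ degLE m j) (hB : B ∈ degLE m k) :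
    A * B ∈ degLE m (j + k) := by
  have h := Submodule.mul_mem_mul hA hB
  rw [degLE, degLE, Submodule.span_mul_span] at h
  refine Submodule.span_mono ?_ h
  rintro _ ⟨A, ⟨T, hT, hA⟩, B, ⟨T', hT', hB⟩, rfl⟩
  exact ⟨T ∪ T', (Finset.card_union_le _ _).trans (add_le_add hT hT'),
    mul_mem (localOps_mono Finset.subset_union_left hA)
      (localOps_mono Finset.subset_union_right hB)⟩

theorem pow_mem_degLE {m k : ℕ} {A : Op m} (hA : A ∈ degLE m k) (r : ℕ) :
    A ^ r ∈ degLE m (r * k) := by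
  induction r with
  | zero => rw [pow_zero]; exact one_mem_degLE _ _
  | succ r ih =>
    rw [pow_succ, Nat.succ_mul]
    exact mul_mem_degLE ih hA

theorem aeval_mem_degLE {m k : ℕ} {A : Op m} (hA : A ∈ degLE m k) (p : Polynomial ℂ) :
    Polynomial.aeval A p ∈ degLE m (p.natDegree * k) := by
  rw [Polynomial.aeval_eq_sum_range]
  refine sum_mem fun i hi => Submodule.smul_mem _ _ ?_
  exact degLE_mono (Nat.mul_le_mul_right _ (Nat.lt_succ_iff.1 (Finset.mem_range.1 hi)))
    (pow_mem_degLE hA i)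

theorem mul_mul_mem_degLE {m j k : ℕ} {B C : Op m}
    (h : ∀ (T : Finset (Fin m)) (A : Op m), T.card ≤ j → A ∈ localOps T → B * A * C ∈ degLE m k)
    {A : Op m} (hA : A ∈ degLE m j) : B * A * C ∈ degLE m k := by
  induction hA using Submodule.span_induction with
  | mem A hA => obtain ⟨T, hT, hA⟩ := hA; exact h T A hT hA
  | zero => simp
  | add A A' _ _ ih ih' => rw [mul_add, add_mul]; exact add_mem ih ih'
  | smul c A _ ih => rw [mul_smul_comm, smul_mul_assoc]; exact Submodule.smul_mem _ _ ih

/-! ### Conjugation by layers -/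

theorem singleQubitLayer_eq {m : ℕ} (u : Fin m → Matrix.unitaryGroup Bool ℂ) :
    singleQubitLayer u = tensor m fun i => (u i : Matrix Bool Bool ℂ) := rfl

theorem conjTranspose_singleQubitLayer {m : ℕ} (u : Fin m → Matrix.unitaryGroup Bool ℂ) :
    (singleQubitLayer u)ᴴ = tensor m fun i => (u i : Matrix Bool Bool ℂ)ᴴ := by
  ext y z
  simp [singleQubitLayer, tensor_apply, Matrix.conjTranspose_apply]

theorem singleQubitLayer_mul_conjTranspose {m : ℕ} (u : Fin m → Matrix.unitaryGroup Bool ℂ) :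
    singleQubitLayer u * (singleQubitLayer u)ᴴ = 1 := by
  rw [conjTranspose_singleQubitLayer, singleQubitLayer_eq, ← map_mul, ← map_one (tensor m)]
  congr 1
  funext i
  exact Matrix.mem_unitaryGroup_iff.1 (u i).2

theorem conjTranspose_mul_singleQubitLayer {m : ℕ} (u : Fin m → Matrix.unitaryGroup Bool ℂ) :
    (singleQubitLayer u)ᴴ * singleQubitLayer u = 1 :=
  mul_eq_one_comm.1 (singleQubitLayer_mul_conjTranspose u)

theorem singleQubitLayer_mul_site {m : ℕ} (u : Fin m → Matrix.unitaryGroup Bool ℂ) (i : Fin m)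
    (v : Matrix Bool Bool ℂ) :
    singleQubitLayer u * site i v =
      site i ((u i : Matrix Bool Bool ℂ) * v * (u i : Matrix Bool Bool ℂ)ᴴ) *
        singleQubitLayer u := by
  rw [singleQubitLayer_eq, site, site, ← map_mul, ← map_mul]
  congr 1
  funext j
  by_cases hj : j = i
  · subst hj
    have : (u j : Matrix Bool Bool ℂ)ᴴ * (u j : Matrix Bool Bool ℂ) = 1 :=
      Matrix.mem_unitaryGroup_iff'.1 (u j).2
    simp [mul_assoc, this]
  · simp [Pi.mulSingle_eq_of_ne hj]

/-- Moving an operator on qubit i through the layer only conjugates it by the i-th unitary, so it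
stays on qubit i. Commutants of sites, and hence supports, are preserved. -/
theorem singleQubitLayer_conj_mem_degLE {m k : ℕ} (u : Fin m → Matrix.unitaryGroup Bool ℂ)
    {A : Op m} (hA : A ∈ degLE m k) :
    (singleQubitLayer u)ᴴ * A * singleQubitLayer u ∈ degLE m k := by
  refine mul_mul_mem_degLE (fun T A hT hA => ?_) hA
  refine mem_degLE_of_mem_localOps hT (mem_localOps.2 fun i hi v => ?_)
  set V := singleQubitLayer u
  set w := (u i : Matrix Bool Bool ℂ) * v * (u i : Matrix Bool Bool ℂ)ᴴ
  have h1 : V * site i v = site i w * V := singleQubitLayer_mul_site u i v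
  have h2 : Vᴴ * site i w = site i v * Vᴴ := by
    calc Vᴴ * site i w = Vᴴ * (site i w * V) * Vᴴ := by
          rw [mul_assoc, mul_assoc, singleQubitLayer_mul_conjTranspose, mul_one]
      _ = site i v * Vᴴ := by
          rw [← h1, ← mul_assoc, conjTranspose_mul_singleQubitLayer, one_mul]
  have h3 : site i w * A = A * site i w := mem_localOps.1 hA i hi w
  change site i v * (Vᴴ * A * V) = Vᴴ * A * V * site i v
  calc site i v * (Vᴴ * A * V) = site i v * Vᴴ * A * V := by simp only [mul_assoc]
    _ = Vᴴ * (site i w * A) * V := by rw [← h2]; simp only [mul_assoc]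
    _ = Vᴴ * A * (site i w * V) := by rw [h3]; simp only [mul_assoc]
    _ = Vᴴ * A * V * site i v := by rw [← h1]; simp only [mul_assoc]

/-- The eigenvalue of `cz S` at a basis vector. -/
def czSign {m : ℕ} (S : Finset (Fin m)) (y : Bits m) : ℝ :=
  if ∀ i ∈ S, y i = true then -1 else 1

/-- The product of the gates in a list. -/
noncomputable def czProd {m : ℕ} (l : List (Finset (Fin m))) : Op m := (l.map cz).prod

theorem czProd_eq_diagonal {m : ℕ} (l : List (Finset (Fin m))) :
    czProd l = Matrix.diagonal fun y => (((l.map fun S => czSign S y).prod : ℝ) : ℂ) := by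
  induction l with
  | nil => simp [czProd]
  | cons S l ih =>
    rw [czProd, List.map_cons, List.prod_cons, ← czProd, ih]
    have : cz S = Matrix.diagonal fun y => ((czSign S y : ℝ) : ℂ) := by
      ext y z
      simp only [cz, allOnesProj, czSign, Matrix.sub_apply, Matrix.smul_apply, Matrix.one_apply,
        Matrix.diagonal_apply]
      split_ifs <;> norm_num
    rw [this, Matrix.diagonal_mul_diagonal]
    simp

theorem czProd_filter {m : ℕ} (p : Finset (Fin m) → Prop) [DecidablePred p]
    (l : List (Finset (Fin m))) :
    czProd l = czProd (l.filter p) * czProd (l.filter (¬ p ·)) := by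
  induction l with
  | nil => simp [czProd]
  | cons S l ih =>
    have hc : ∀ l' : List (Finset (Fin m)), Commute (cz S) (czProd l') := fun l' => by
      have h1 : cz S = czProd [S] := by simp [czProd]
      rw [h1, czProd_eq_diagonal, czProd_eq_diagonal]
      exact Matrix.commute_diagonal _ _
    have hcons : ∀ l', czProd (S :: l') = cz S * czProd l' := fun l' => by simp [czProd]
    by_cases h : p S
    · rw [List.filter_cons_of_pos (by simpa using h), List.filter_cons_of_neg (by simpa using h),
        hcons, hcons, ih, mul_assoc]
    · rw [List.filter_cons_of_neg (by simpa using h), List.filter_cons_of_pos (by simpa using h),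
        hcons, hcons, ih, ← mul_assoc, (hc _).eq, mul_assoc]

theorem czProd_mul_self {m : ℕ} (l : List (Finset (Fin m))) : czProd l * czProd l = 1 := by
  rw [czProd_eq_diagonal, Matrix.diagonal_mul_diagonal, ← Matrix.diagonal_one]
  congr 1
  funext y
  rw [← Complex.ofReal_mul, ← List.prod_map_mul]
  have : (fun S : Finset (Fin m) => czSign S y * czSign S y) = fun _ => 1 := by
    funext S
    simp only [czSign]
    split_ifs <;> norm_num
  rw [this]
  simp

theorem conjTranspose_czProd {m : ℕ} (l : List (Finset (Fin m))) : (czProd l)ᴴ = czProd l := by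
  rw [czProd_eq_diagonal, Matrix.diagonal_conjTranspose]
  congr 1
  funext y
  simp

/-- Light cone: gates disjoint from the support T commute with A and cancel, being involutions. Each
qubit of T lies in at most one gate, so the surviving gates enlarge T to at most σ times its size.
-/
theorem czProd_conj_mem_degLE {m k σ : ℕ} (hσ : 1 ≤ σ) {l : List (Finset (Fin m))}
    (hd : l.Pairwise Disjoint) (hl : ∀ S ∈ l, S.card ≤ σ) {A : Op m} (hA : A ∈ degLE m k) :
    czProd l * A * czProd l ∈ degLE m (σ * k) := by
  classical
  refine mul_mul_mem_degLE (fun T A hT hA => ?_) hA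
  -- The qubit i itself is included because no gate need touch it; this is where 1 ≤ σ enters.
  let cov : Fin m → Finset (Fin m) := fun i =>
    Finset.univ.filter fun j => j = i ∨ ∃ S ∈ l, i ∈ S ∧ j ∈ S
  have hcov : ∀ i, (cov i).card ≤ σ := fun i => by
    by_cases h : ∃ S ∈ l, i ∈ S
    · obtain ⟨S, hS, hi⟩ := h
      refine (Finset.card_le_card fun j hj => ?_).trans (hl S hS)
      obtain rfl | ⟨S', hS', hi', hj'⟩ := (Finset.mem_filter.1 hj).2
      · exact hi
      · by_contra hjS
        have hne : S' ≠ S := fun h => hjS (h ▸ hj')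
        have hdis : Disjoint S' S :=
          hd.forall hS' hS hne
        exact Finset.disjoint_left.1 hdis hi' hi
    · refine (Finset.card_le_card (t := {i}) fun j hj => ?_).trans (by simpa using hσ)
      obtain rfl | ⟨S', hS', hi', _⟩ := (Finset.mem_filter.1 hj).2
      · simp
      · exact absurd ⟨S', hS', hi'⟩ h
  have hcard : (T.biUnion cov).card ≤ σ * k :=
    (Finset.card_biUnion_le_card_mul T cov σ fun i _ => hcov i).trans
      (by rw [mul_comm]; exact Nat.mul_le_mul_left σ hT)
  refine mem_degLE_of_mem_localOps hcard ?_
  have hTsub : T ⊆ T.biUnion cov := fun i hi =>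
    Finset.mem_biUnion.2 ⟨i, hi, by simp [cov]⟩
  have hQ : czProd (l.filter (¬ Disjoint · T)) ∈ localOps (T.biUnion cov) := by
    refine Subalgebra.list_prod_mem _ fun B hB => ?_
    obtain ⟨S, hS, rfl⟩ := List.mem_map.1 hB
    rw [List.mem_filter, decide_eq_true_iff, Finset.not_disjoint_iff] at hS
    obtain ⟨hS, i, hiS, hiT⟩ := hS
    refine localOps_mono (fun j hj => Finset.mem_biUnion.2 ⟨i, hiT, ?_⟩) (cz_mem_localOps S)
    simp only [cov, Finset.mem_filter, Finset.mem_univ, true_and]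
    exact Or.inr ⟨S, hS, hiS, hj⟩
  have hR : Commute A (czProd (l.filter (Disjoint · T))) := by
    refine Commute.list_prod_right _ _ fun B hB => ?_
    obtain ⟨S, hS, rfl⟩ := List.mem_map.1 hB
    rw [List.mem_filter, decide_eq_true_iff] at hS
    exact (cz_commute hS.2 hA).symm
  set R := czProd (l.filter (Disjoint · T))
  set Q := czProd (l.filter (¬ Disjoint · T))
  have hRQ : czProd l = R * Q := czProd_filter _ l
  have hcomm : R * Q = Q * R := by
    simp only [R, Q, czProd_eq_diagonal]
    exact (Matrix.commute_diagonal _ _).eq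
  have : czProd l * A * czProd l = Q * A * Q := by
    calc czProd l * A * czProd l = Q * (R * A) * (R * Q) := by
          rw [hRQ]; nth_rewrite 1 [hcomm]; simp only [mul_assoc]
      _ = Q * A * (R * R) * Q := by rw [← hR.eq]; simp only [mul_assoc]
      _ = Q * A * Q := by rw [czProd_mul_self, mul_one]
  rw [this]
  exact mul_mem (mul_mem hQ (localOps_mono hTsub hA)) hQ

/-! ### Polynomial approximation of gates on many qubits -/

/-- A Chebyshev polynomial that approximates the indicator of `s` on `{0, …, s}`. -/
theorem exists_polynomial_peak (s r : ℕ) (hs : 1 ≤ s) :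
    ∃ q : Polynomial ℝ, q.natDegree ≤ 2 * r ∧ q.eval (s : ℝ) = 1 ∧
      ∀ t : ℕ, t < s → 0 ≤ q.eval (t : ℝ) ∧ q.eval (t : ℝ) ≤ 4 * Real.exp (-(2 * r / √(s : ℝ))) := by
  have hs' : (1 : ℝ) ≤ s := by exact_mod_cast hs
  have hs0 : (0 : ℝ) < s := by linarith
  -- The affine map x ↦ δx + 1 − δ(s − 1) sends s − 1 to 1 and s to cosh u. So T_r stays bounded by
  -- 1 on the counts below s and equals cosh(ru) at s.
  set u : ℝ := 1 / √(s : ℝ) with hu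
  have husq : u ^ 2 = 1 / s := by rw [hu, div_pow, Real.sq_sqrt hs0.le, one_pow]
  set δ : ℝ := Real.cosh u - 1 with hδ
  have hδ0 : 0 ≤ δ := by have := Real.one_le_cosh u; linarith
  -- Here cosh u ≤ exp(u²/2) ≤ 1 + u² for u ≤ 1. The bound keeps the image of [0, s − 1] inside [−1,
  -- 1].
  have hδ1 : δ ≤ 1 / s := by
    have h1 := Real.cosh_le_exp_half_sq u
    have h2 : u ^ 2 ≤ 1 := by rw [husq, div_le_one hs0]; exact hs'
    have h3 : 1 - u ^ 2 / 2 ≤ Real.exp (-(u ^ 2 / 2)) := Real.one_sub_le_exp_neg _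
    have h4 : Real.exp (u ^ 2 / 2) * Real.exp (-(u ^ 2 / 2)) = 1 := by
      rw [← Real.exp_add]; simp
    have h5 : Real.exp (u ^ 2 / 2) * (1 - u ^ 2 / 2) ≤ 1 :=
      (mul_le_mul_of_nonneg_left h3 (Real.exp_pos _).le).trans_eq h4
    have h6 : Real.exp (u ^ 2 / 2) ≤ 1 + u ^ 2 := by
      by_contra hcon
      push Not at hcon
      nlinarith [sq_nonneg u]
    rw [hδ, ← husq]
    linarith
  set c : ℝ := Real.cosh (r * u) with hc
  have hc1 : 1 ≤ c := Real.one_le_cosh _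
  have hc0 : 0 < c := by linarith
  -- The square makes q nonnegative, and c² normalizes the peak value to 1.
  set q : Polynomial ℝ := Polynomial.C (1 / c ^ 2) *
    ((Polynomial.Chebyshev.T ℝ r).comp
      (Polynomial.C δ * Polynomial.X + Polynomial.C (1 - δ * (s - 1)))) ^ 2 with hq
  have heval : ∀ x : ℝ, q.eval x =
      1 / c ^ 2 * ((Polynomial.Chebyshev.T ℝ r).eval (δ * x + (1 - δ * (s - 1)))) ^ 2 := by
    intro x
    simp [hq, Polynomial.eval_comp]
  refine ⟨q, ?_, ?_, fun t ht => ?_⟩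
  · refine (Polynomial.natDegree_C_mul_le _ _).trans ?_
    refine Polynomial.natDegree_pow_le.trans (Nat.mul_le_mul_left 2 ?_)
    refine Polynomial.natDegree_comp_le.trans ?_
    rw [Polynomial.Chebyshev.natDegree_T, Int.natAbs_natCast]
    calc r * _ ≤ r * 1 := Nat.mul_le_mul_left r Polynomial.natDegree_linear_le
      _ = r := mul_one r
  · have hx : δ * (s : ℝ) + (1 - δ * (s - 1)) = Real.cosh u := by rw [hδ]; ring
    rw [heval, hx, Polynomial.Chebyshev.T_real_cosh, Int.cast_natCast, ← hc]
    field_simp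
  · rw [heval]
    refine ⟨by positivity, ?_⟩
    have ht' : (t : ℝ) + 1 ≤ s := by exact_mod_cast ht
    have ht0 : (0 : ℝ) ≤ t := Nat.cast_nonneg t
    have hδs : δ * s ≤ 1 := by rwa [le_div_iff₀ hs0] at hδ1
    have habs : |δ * (t : ℝ) + (1 - δ * (s - 1))| ≤ 1 := by
      rw [abs_le]
      constructor <;> nlinarith
    have hT := Polynomial.Chebyshev.abs_eval_T_real_le_one r habs
    have hT2 := (sq_le_one_iff_abs_le_one _).2 hT
    have hcexp : Real.exp (r * u) / 2 ≤ c := by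
      rw [hc, Real.cosh_eq]
      have := Real.exp_pos (-(r * u))
      linarith
    have hexp : Real.exp (-(2 * r / √(s : ℝ))) = 1 / Real.exp (r * u) ^ 2 := by
      rw [← Real.exp_nat_mul, one_div, ← Real.exp_neg]
      congr 1
      rw [hu]
      push_cast
      ring
    rw [hexp]
    have he := Real.exp_pos (r * u)
    calc 1 / c ^ 2 * _ ≤ 1 / c ^ 2 * 1 := mul_le_mul_of_nonneg_left hT2 (by positivity)
      _ ≤ 1 / (Real.exp (r * u) / 2) ^ 2 := by
        rw [mul_one]
        exact one_div_le_one_div_of_le (by positivity) (pow_le_pow_left₀ (by positivity) hcexp 2)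
      _ = 4 * (1 / Real.exp (r * u) ^ 2) := by field_simp; norm_num

/-- The number of ones among the qubits in `S`. -/
def countOn {m : ℕ} (S : Finset (Fin m)) (y : Bits m) : ℕ := (S.filter fun i => y i = true).card

theorem diagonal_countOn_mem_degLE {m : ℕ} (S : Finset (Fin m)) :
    (Matrix.diagonal fun y => (countOn S y : ℂ)) ∈ degLE m 1 := by
  have : (Matrix.diagonal fun y => (countOn S y : ℂ)) = ∑ i ∈ S, site i oneProj := by
    ext y z
    rw [Matrix.sum_apply]
    simp only [site_oneProj, Matrix.diagonal_apply, countOn]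
    split_ifs
    · simp
    · simp
  rw [this]
  exact sum_mem fun i _ => mem_degLE_of_mem_localOps (T := {i}) (by simp) (site_mem_localOps i _)

/-- The counting operator is a sum of one-qubit projections, hence of degree 1. Polynomial
evaluation passes through the diagonal embedding. -/
theorem diagonal_eval_countOn_mem_degLE {m : ℕ} (S : Finset (Fin m)) (q : Polynomial ℝ) :
    (Matrix.diagonal fun y => ((q.eval (countOn S y : ℝ) : ℝ) : ℂ)) ∈ degLE m q.natDegree := by
  have h := aeval_mem_degLE (diagonal_countOn_mem_degLE S) (q.map (algebraMap ℝ ℂ))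
  rw [Polynomial.natDegree_map, mul_one] at h
  convert h using 1
  have hd : (Matrix.diagonal fun y => (countOn S y : ℂ)) =
      Matrix.diagonalAlgHom ℂ fun y : Bits m => (countOn S y : ℂ) := rfl
  rw [hd, Polynomial.aeval_algHom_apply, Matrix.diagonalAlgHom_apply]
  congr 1
  funext y
  have := Polynomial.aeval_algHom_apply (Pi.evalAlgHom ℂ (fun _ : Bits m => ℂ) y)
    (fun y : Bits m => (countOn S y : ℂ)) (q.map (algebraMap ℝ ℂ))
  simp only [Pi.evalAlgHom_apply] at this
  rw [← this, Polynomial.aeval_map_algebraMap]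
  rw [← Complex.ofReal_natCast, ← Complex.coe_algebraMap, Polynomial.aeval_algebraMap_apply]
  simp

theorem half_le_log_succ {m : ℕ} (hm : 1 ≤ m) : 1 / 2 ≤ Real.log ((m : ℝ) + 1) := by
  have h1 : (1 : ℝ) ≤ m := by exact_mod_cast hm
  have h2 : Real.log 2 ≤ Real.log ((m : ℝ) + 1) := Real.log_le_log (by norm_num) (by linarith)
  have := Real.log_two_gt_d9
  linarith

/-- A single gate is close to a diagonal operator of low degree. -/
theorem exists_gate_approx {m : ℕ} {S : Finset (Fin m)} (hS : S.Nonempty) :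
    ∃ (g : Bits m → ℝ) (k : ℕ), (Matrix.diagonal fun y => (g y : ℂ)) ∈ degLE m k ∧
      (k : ℝ) ≤ 8 * Real.log ((m : ℝ) + 1) * √(S.card : ℝ) ∧ (∀ y, |g y| ≤ 1) ∧
      ∀ y, |g y - czSign S y| ≤ 2 / (m : ℝ) ^ 2 := by
  obtain ⟨i₀, hi₀⟩ := hS
  have hs : 1 ≤ S.card := Finset.card_pos.2 ⟨i₀, hi₀⟩
  have hm : 1 ≤ m := Nat.one_le_iff_ne_zero.2 fun h => by subst h; exact i₀.elim0
  have hm1 : (1 : ℝ) ≤ m := by exact_mod_cast hm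
  have hs1 : (1 : ℝ) ≤ S.card := by exact_mod_cast hs
  have hsq : 1 ≤ √(S.card : ℝ) := Real.one_le_sqrt.2 hs1
  have hl := half_le_log_succ hm
  -- Chosen so that 4 exp(−Λ) = 1/m². The ceiling r below then gives 2r/√s ≥ Λ, with s the gate
  -- size.
  set Λ := Real.log (4 * (m : ℝ) ^ 2) with hΛ
  have hΛ0 : 0 ≤ Λ := Real.log_nonneg (by nlinarith)
  have hΛ1 : Λ ≤ 4 * Real.log ((m : ℝ) + 1) := by
    have : Λ ≤ Real.log (((m : ℝ) + 1) ^ 4) :=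
      Real.log_le_log (by positivity) (by nlinarith [sq_nonneg ((m : ℝ) - 1), sq_nonneg ((m : ℝ) ^ 2)])
    rwa [Real.log_pow, Nat.cast_ofNat] at this
  set r := ⌈√(S.card : ℝ) * Λ / 2⌉₊ with hr
  have hr1 : √(S.card : ℝ) * Λ / 2 ≤ r := Nat.le_ceil _
  have hr2 : (r : ℝ) < √(S.card : ℝ) * Λ / 2 + 1 := Nat.ceil_lt_add_one (by positivity)
  obtain ⟨q, hdeg, hqs, hqt⟩ := exists_polynomial_peak S.card r hs
  have hε : 4 * Real.exp (-(2 * r / √(S.card : ℝ))) ≤ 1 / (m : ℝ) ^ 2 := by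
    have h1 : Λ ≤ 2 * r / √(S.card : ℝ) := by
      rw [le_div_iff₀ (by linarith)]; linarith
    have h2 : Real.exp (-(2 * r / √(S.card : ℝ))) ≤ Real.exp (-Λ) :=
      Real.exp_le_exp.2 (by linarith)
    rw [Real.exp_neg Λ, hΛ, Real.exp_log (by positivity)] at h2
    calc _ ≤ 4 * (4 * (m : ℝ) ^ 2)⁻¹ := by linarith
      _ = 1 / (m : ℝ) ^ 2 := by field_simp
  have hε1 : 1 / (m : ℝ) ^ 2 ≤ 1 := by
    rw [div_le_one (by positivity)]; nlinarith
  -- The polynomial q replaces the projection in id − 2|1⋯1⟩⟨1⋯1|. Since 0 ≤ q ≤ 1 on all counts,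
  -- the approximant has modulus at most 1, and so does not amplify later errors.
  have hkey : ∀ y : Bits m, |1 - 2 * q.eval (countOn S y : ℝ)| ≤ 1 ∧
      |1 - 2 * q.eval (countOn S y : ℝ) - czSign S y| ≤ 2 / (m : ℝ) ^ 2 := by
    intro y
    by_cases h : ∀ i ∈ S, y i = true
    · have hc : countOn S y = S.card := by
        rw [countOn, Finset.filter_true_of_mem h]
      rw [hc, hqs, czSign, if_pos h]
      norm_num
      positivity
    · have hc : countOn S y < S.card := by
        refine Finset.card_lt_card (Finset.filter_ssubset.2 ?_)
        push Not at h
        obtain ⟨i, hi, hy⟩ := h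
        exact ⟨i, hi, hy⟩
      obtain ⟨h0, h1⟩ := hqt _ hc
      have h2 := h1.trans hε
      have h3 : 2 / (m : ℝ) ^ 2 = 2 * (1 / (m : ℝ) ^ 2) := by ring
      rw [czSign, if_neg h, h3]
      constructor <;> rw [abs_le] <;> constructor <;> linarith
  refine ⟨fun y => 1 - 2 * q.eval (countOn S y : ℝ), q.natDegree, ?_, ?_, fun y => (hkey y).1,
    fun y => (hkey y).2⟩
  · have : (Matrix.diagonal fun y => ((1 - 2 * q.eval (countOn S y : ℝ) : ℝ) : ℂ)) =
        1 - (2 : ℂ) • Matrix.diagonal fun y => ((q.eval (countOn S y : ℝ) : ℝ) : ℂ) := by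
      ext y z
      simp only [Matrix.sub_apply, Matrix.smul_apply, Matrix.one_apply, Matrix.diagonal_apply]
      split_ifs <;> simp
    rw [this]
    exact sub_mem (one_mem_degLE m _)
      (Submodule.smul_mem _ _ (diagonal_eval_countOn_mem_degLE S q))
  · have : (q.natDegree : ℝ) ≤ 2 * r := by exact_mod_cast hdeg
    nlinarith

/-- A list of gates is close to a diagonal operator of low degree. -/
theorem exists_gates_approx {m : ℕ} {l : List (Finset (Fin m))} (hl : ∀ S ∈ l, S.Nonempty) :
    ∃ (g : Bits m → ℝ) (k : ℕ), (Matrix.diagonal fun y => (g y : ℂ)) ∈ degLE m k ∧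
      (k : ℝ) ≤ 8 * Real.log ((m : ℝ) + 1) * (l.map fun S => √(S.card : ℝ)).sum ∧
      (∀ y, |g y| ≤ 1) ∧
      ∀ y, |g y - (l.map fun S => czSign S y).prod| ≤ l.length * (2 / (m : ℝ) ^ 2) := by
  induction l with
  | nil =>
    refine ⟨fun _ => 1, 0, ?_, by simp, by simp, by simp⟩
    have : (Matrix.diagonal fun _ : Bits m => ((1 : ℝ) : ℂ)) = 1 := by simp
    rw [this]
    exact one_mem_degLE m 0
  | cons S l ih =>
    obtain ⟨g, k, hg, hk, hg1, hgε⟩ := ih fun S' hS' => hl S' (List.mem_cons_of_mem _ hS')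
    obtain ⟨g', k', hg', hk', hg1', hgε'⟩ := exists_gate_approx (hl S List.mem_cons_self)
    refine ⟨fun y => g' y * g y, k' + k, ?_, ?_, fun y => ?_, fun y => ?_⟩
    · have := mul_mem_degLE hg' hg
      rw [Matrix.diagonal_mul_diagonal] at this
      simpa using this
    · rw [List.map_cons, List.sum_cons]
      push_cast
      linarith
    · rw [abs_mul]
      exact mul_le_one₀ (hg1' y) (abs_nonneg _) (hg1 y)
    · rw [List.map_cons, List.prod_cons, List.length_cons]
      set p := (l.map fun S => czSign S y).prod
      have hs : |czSign S y| ≤ 1 := by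
        rw [czSign]; split_ifs <;> simp
      -- Factors of modulus at most 1 can be exchanged one at a time, so their errors add.
      have h1 : g' y * g y - czSign S y * p =
          (g' y - czSign S y) * g y + czSign S y * (g y - p) := by ring
      rw [h1]
      refine (abs_add_le _ _).trans ?_
      rw [abs_mul, abs_mul]
      have h2 : |g' y - czSign S y| * |g y| ≤ 2 / (m : ℝ) ^ 2 * 1 :=
        mul_le_mul (hgε' y) (hg1 y) (abs_nonneg _) (by positivity)
      have h3 : |czSign S y| * |g y - p| ≤ 1 * (l.length * (2 / (m : ℝ) ^ 2)) :=
        mul_le_mul hs (hgε y) (abs_nonneg _) zero_le_one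
      push_cast
      linarith

theorem sum_card_le_of_pairwise_disjoint {α : Type*} [DecidableEq α] {l : List (Finset α)}
    (hd : l.Pairwise Disjoint) {V : Finset α} (hV : ∀ S ∈ l, S ⊆ V) :
    (l.map Finset.card).sum ≤ V.card := by
  induction l generalizing V with
  | nil => simp
  | cons S l ih =>
    rw [List.pairwise_cons] at hd
    rw [List.map_cons, List.sum_cons]
    have h1 := ih hd.2 (V := V \ S) fun S' hS' => Finset.subset_sdiff.2
      ⟨hV S' (List.mem_cons_of_mem _ hS'), (hd.1 S' hS').symm⟩
    have h2 := Finset.card_sdiff_add_card_eq_card (hV S List.mem_cons_self)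
    omega

/-- A product of disjoint gates on more than `σ` qubits each is close to a diagonal operator
of low degree. -/
theorem exists_large_gates_approx {m : ℕ} (hm : 1 ≤ m) {l : List (Finset (Fin m))}
    (hl : ∀ S ∈ l, S.Nonempty) (hd : l.Pairwise Disjoint) {σ : ℝ} (hσ : 0 < σ)
    (hlσ : ∀ S ∈ l, σ ≤ S.card) :
    ∃ (g : Bits m → ℝ) (k : ℕ), (Matrix.diagonal fun y => (g y : ℂ)) ∈ degLE m k ∧
      (k : ℝ) ≤ 8 * Real.log ((m : ℝ) + 1) * (m / √σ) ∧ (∀ y, |g y| ≤ 1) ∧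
      ∀ y, |g y - (l.map fun S => czSign S y).prod| ≤ 2 / m := by
  have hm1 : (1 : ℝ) ≤ m := by exact_mod_cast hm
  have hl' := half_le_log_succ hm
  have hsum : (l.map Finset.card).sum ≤ m := by
    simpa using sum_card_le_of_pairwise_disjoint hd (V := Finset.univ) fun S _ => S.subset_univ
  have hlen : l.length ≤ m := by
    refine le_trans ?_ hsum
    clear hsum hd hlσ
    induction l with
    | nil => simp
    | cons S l ih =>
      have h1 := ih fun S' hS' => hl S' (List.mem_cons_of_mem _ hS')
      have h2 := Finset.card_pos.2 (hl S List.mem_cons_self)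
      simp only [List.length_cons, List.map_cons, List.sum_cons]
      omega
  -- A gate of size s ≥ σ costs √s ≤ s/√σ, and the sizes of disjoint gates sum to at most m.
  have hsqrt : (l.map fun S => √(S.card : ℝ)).sum ≤ ((l.map Finset.card).sum : ℕ) / √σ := by
    clear hsum hd hl hlen
    induction l with
    | nil => simp
    | cons S l ih =>
      have h1 := ih fun S' hS' => hlσ S' (List.mem_cons_of_mem _ hS')
      have h2 := hlσ S List.mem_cons_self
      have h3 : √(S.card : ℝ) ≤ S.card / √σ := by
        rw [le_div_iff₀ (Real.sqrt_pos.2 hσ)]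
        calc √(S.card : ℝ) * √σ ≤ √(S.card : ℝ) * √(S.card : ℝ) :=
              mul_le_mul_of_nonneg_left (Real.sqrt_le_sqrt h2) (Real.sqrt_nonneg _)
          _ = S.card := Real.mul_self_sqrt (by positivity)
      simp only [List.map_cons, List.sum_cons]
      push_cast at h1 ⊢
      rw [add_div]
      linarith
  obtain ⟨g, k, hg, hk, hg1, hgε⟩ := exists_gates_approx hl
  refine ⟨g, k, hg, hk.trans ?_, hg1, fun y => (hgε y).trans ?_⟩
  · refine mul_le_mul_of_nonneg_left (hsqrt.trans ?_) (by linarith)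
    exact div_le_div_of_nonneg_right (by exact_mod_cast hsum) (Real.sqrt_nonneg _)
  · calc (l.length : ℝ) * (2 / (m : ℝ) ^ 2) ≤ m * (2 / (m : ℝ) ^ 2) :=
          mul_le_mul_of_nonneg_right (by exact_mod_cast hlen) (by positivity)
      _ = 2 / m := by field_simp

open scoped Matrix.Norms.L2Operator

/-! ### Low-degree approximation of circuits in operator norm -/

theorem norm_diagonal_le {m : ℕ} {g : Bits m → ℂ} {c : ℝ} (hc : 0 ≤ c) (hg : ∀ y, ‖g y‖ ≤ c) :
    ‖(Matrix.diagonal g : Op m)‖ ≤ c := by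
  rw [Matrix.l2_opNorm_diagonal]
  exact (pi_norm_le_iff_of_nonneg hc).2 hg

theorem norm_le_one_of_conjTranspose_mul_self {m : ℕ} {V : Op m} (h : Vᴴ * V = 1) : ‖V‖ ≤ 1 := by
  have h1 := Matrix.l2_opNorm_conjTranspose_mul_self V
  have h2 : ‖(1 : Op m)‖ ≤ 1 := by
    rw [← Matrix.diagonal_one]
    exact norm_diagonal_le zero_le_one fun y => by simp
  rw [h] at h1
  nlinarith [norm_nonneg V]

theorem norm_conj_le {m : ℕ} {V W A : Op m} (hV : ‖V‖ ≤ 1) (hW : ‖W‖ ≤ 1) :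
    ‖V * A * W‖ ≤ ‖A‖ := by
  calc ‖V * A * W‖ ≤ ‖V * A‖ * ‖W‖ := norm_mul_le _ _
    _ ≤ ‖V‖ * ‖A‖ * ‖W‖ := mul_le_mul_of_nonneg_right (norm_mul_le _ _) (norm_nonneg _)
    _ ≤ 1 * ‖A‖ * 1 := by gcongr
    _ = ‖A‖ := by ring

/-- `A` is within `e` of an operator of degree at most `D`. -/
def ApproxDeg {m : ℕ} (A : Op m) (D e : ℝ) : Prop :=
  ∃ (B : Op m) (k : ℕ), (k : ℝ) ≤ D ∧ B ∈ degLE m k ∧ ‖A - B‖ ≤ e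

theorem ApproxDeg.mono {m : ℕ} {A : Op m} {D D' e e' : ℝ} (h : ApproxDeg A D e) (hD : D ≤ D')
    (he : e ≤ e') : ApproxDeg A D' e' := by
  obtain ⟨B, k, hk, hB, hA⟩ := h
  exact ⟨B, k, hk.trans hD, hB, hA.trans he⟩

theorem approxDeg_of_le {m : ℕ} (A : Op m) {D e : ℝ} (hD : (m : ℝ) ≤ D) (he : 0 ≤ e) :
    ApproxDeg A D e :=
  ⟨A, m, hD, mem_degLE_self A, by simpa using he⟩

theorem norm_singleQubitLayer_le {m : ℕ} (u : Fin m → Matrix.unitaryGroup Bool ℂ) :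
    ‖singleQubitLayer u‖ ≤ 1 :=
  norm_le_one_of_conjTranspose_mul_self (conjTranspose_mul_singleQubitLayer u)

theorem norm_czProd_le {m : ℕ} (l : List (Finset (Fin m))) : ‖czProd l‖ ≤ 1 :=
  norm_le_one_of_conjTranspose_mul_self (by rw [conjTranspose_czProd, czProd_mul_self])

theorem ApproxDeg.singleQubitLayer_conj {m : ℕ} {A : Op m} {D e : ℝ} (h : ApproxDeg A D e)
    (u : Fin m → Matrix.unitaryGroup Bool ℂ) :
    ApproxDeg ((singleQubitLayer u)ᴴ * A * singleQubitLayer u) D e := by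
  obtain ⟨B, k, hk, hB, hAB⟩ := h
  refine ⟨_, k, hk, singleQubitLayer_conj_mem_degLE u hB, ?_⟩
  rw [← sub_mul, ← mul_sub]
  refine (norm_conj_le ?_ (norm_singleQubitLayer_le u)).trans hAB
  rw [Matrix.l2_opNorm_conjTranspose]
  exact norm_singleQubitLayer_le u

/-- Small gates are conjugated exactly and contribute the factor σ. The product of the large ones is
replaced by a low-degree diagonal operator on both sides, which doubles its degree bound 8 log(m +
1) · m/√σ and its error 2/m. -/
theorem ApproxDeg.czProd_conj {m : ℕ} (hm : 1 ≤ m) {A : Op m} {D e σ : ℝ} (h : ApproxDeg A D e)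
    (hA : ‖A‖ ≤ 1) (hσ : 1 ≤ σ) {l : List (Finset (Fin m))} (hl : ∀ S ∈ l, S.Nonempty)
    (hd : l.Pairwise Disjoint) :
    ApproxDeg (czProd l * A * czProd l)
      (σ * D + 16 * Real.log ((m : ℝ) + 1) * (m / √σ)) (e + 4 / m) := by
  classical
  obtain ⟨B, k, hk, hB, hAB⟩ := h
  set l₁ := l.filter fun S => S.card ≤ ⌊σ⌋₊
  set l₂ := l.filter fun S => ¬ S.card ≤ ⌊σ⌋₊
  have hσ0 : 0 ≤ σ := by linarith
  have hσ1 : 1 ≤ ⌊σ⌋₊ := (Nat.one_le_floor_iff σ).2 hσ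
  have h1 : czProd l₁ * B * czProd l₁ ∈ degLE m (⌊σ⌋₊ * k) :=
    czProd_conj_mem_degLE hσ1 (hd.filter _)
      (fun S hS => by simpa using (List.mem_filter.1 hS).2) hB
  obtain ⟨g, k', hg, hk', hg1, hgε⟩ := exists_large_gates_approx hm (l := l₂) (σ := σ)
    (fun S hS => hl S (List.mem_filter.1 hS).1) (hd.filter _) (by linarith) fun S hS => by
      have h := (List.mem_filter.1 hS).2
      rw [decide_eq_true_iff, not_le] at h
      exact ((Nat.floor_lt hσ0).1 h).le
  set G : Op m := Matrix.diagonal fun y => (g y : ℂ)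
  have hG : ‖G‖ ≤ 1 := norm_diagonal_le zero_le_one fun y => by simpa using hg1 y
  have hGε : ‖czProd l₂ - G‖ ≤ 2 / m := by
    rw [czProd_eq_diagonal, Matrix.diagonal_sub]
    refine norm_diagonal_le (by positivity) fun y => ?_
    rw [← Complex.ofReal_sub, Complex.norm_real, Real.norm_eq_abs, abs_sub_comm]
    exact hgε y
  refine ⟨G * (czProd l₁ * B * czProd l₁) * G, k' + ⌊σ⌋₊ * k + k', ?_,
    mul_mem_degLE (mul_mem_degLE hg h1) hg, ?_⟩
  · have h2 : (⌊σ⌋₊ : ℝ) * k ≤ σ * D :=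
      mul_le_mul (Nat.floor_le hσ0) hk (Nat.cast_nonneg k) hσ0
    push_cast
    linarith
  · set P := czProd l₁
    set Q := czProd l₂
    have hP : ‖P‖ ≤ 1 := norm_czProd_le l₁
    have hQ : ‖Q‖ ≤ 1 := norm_czProd_le l₂
    have hl : czProd l = P * Q := czProd_filter (fun S => S.card ≤ ⌊σ⌋₊) l
    have hPQ : P * Q = Q * P := by
      simp only [P, Q, czProd_eq_diagonal]
      exact (Matrix.commute_diagonal _ _).eq
    have hR : ‖P * A * P‖ ≤ 1 := (norm_conj_le hP hP).trans hA
    -- Hybrid argument: replace the left Q, then the right Q, then A. The other factors have norm at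
    -- most 1.
    have heq : czProd l * A * czProd l - G * (P * B * P) * G =
        (Q - G) * (P * A * P) * Q + G * (P * A * P) * (Q - G) + G * (P * (A - B) * P) * G := by
      rw [hl]
      nth_rewrite 1 [hPQ]
      noncomm_ring
    rw [heq]
    have e1 : ‖(Q - G) * (P * A * P) * Q‖ ≤ 2 / m :=
      calc _ ≤ ‖Q - G‖ * ‖P * A * P‖ * ‖Q‖ :=
            (norm_mul_le _ _).trans (mul_le_mul_of_nonneg_right (norm_mul_le _ _) (norm_nonneg _))
        _ ≤ 2 / m * 1 * 1 := by gcongr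
        _ = 2 / m := by ring
    have e2 : ‖G * (P * A * P) * (Q - G)‖ ≤ 2 / m :=
      calc _ ≤ ‖G‖ * ‖P * A * P‖ * ‖Q - G‖ :=
            (norm_mul_le _ _).trans (mul_le_mul_of_nonneg_right (norm_mul_le _ _) (norm_nonneg _))
        _ ≤ 1 * 1 * (2 / m) := by gcongr
        _ = 2 / m := by ring
    have e3 : ‖G * (P * (A - B) * P) * G‖ ≤ e :=
      ((norm_conj_le hG hG).trans (norm_conj_le hP hP)).trans hAB
    have e4 := norm_add₃_le (a := (Q - G) * (P * A * P) * Q) (b := G * (P * A * P) * (Q - G))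
      (c := G * (P * (A - B) * P) * G)
    have : (4 : ℝ) / m = 2 / m + 2 / m := by ring
    linarith

/-- The degree that suffices to approximate a circuit of depth `d` on `m` qubits. -/
noncomputable def circuitDegree (m d : ℕ) : ℝ :=
  (m : ℝ) ^ (1 - 1 / (3 : ℝ) ^ d) * (1 + 16 * Real.log ((m : ℝ) + 1)) ^ 2

/-- With σ = 1/w² the first term σD is mp ≤ mw and m/√σ is mw, so the new degree is at most mwX =
mpX². The power X² reproduces itself, which is why the logarithmic exponent does not grow with the
depth. -/
theorem ApproxDeg.czProd_conj_circuitDegree {m : ℕ} (hm : 1 ≤ m) {A : Op m} {d : ℕ} {e : ℝ}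
    (he : 0 ≤ e) (h : ApproxDeg A (circuitDegree m d) e) (hA : ‖A‖ ≤ 1)
    {l : List (Finset (Fin m))} (hl : ∀ S ∈ l, S.Nonempty) (hd : l.Pairwise Disjoint) :
    ApproxDeg (czProd l * A * czProd l) (circuitDegree m (d + 1)) (e + 4 / m) := by
  have hm0 : (0 : ℝ) < m := by exact_mod_cast hm
  set X := 1 + 16 * Real.log ((m : ℝ) + 1) with hX
  have hX1 : 1 ≤ X := by have := half_le_log_succ hm; linarith
  set p : ℝ := (m : ℝ) ^ (-(1 / (3 : ℝ) ^ (d + 1))) with hp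
  have hp0 : 0 < p := Real.rpow_pos_of_pos hm0 _
  have hnext : circuitDegree m (d + 1) = m * (p * X) * X := by
    rw [circuitDegree, sub_eq_add_neg, Real.rpow_add hm0, Real.rpow_one]
    ring
  have hcur : circuitDegree m d = m * p ^ 3 * X ^ 2 := by
    rw [circuitDegree, sub_eq_add_neg, Real.rpow_add hm0, Real.rpow_one, hp,
      ← Real.rpow_mul_natCast hm0.le]
    congr 3
    rw [pow_succ]
    push_cast
    field_simp
  set w := p * X with hw
  have hw0 : 0 < w := mul_pos hp0 (by linarith)
  by_cases hw1 : w ≤ 1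
  · have hσ : 1 ≤ 1 / w ^ 2 := by
      rw [le_div_iff₀ (by positivity), one_mul]
      exact pow_le_one₀ hw0.le hw1
    refine (h.czProd_conj hm hA hσ hl hd).mono ?_ le_rfl
    have hs : √(1 / w ^ 2) = 1 / w := by
      rw [Real.sqrt_div zero_le_one, Real.sqrt_one, Real.sqrt_sq hw0.le]
    rw [hs, hnext, hcur]
    have h1 : 1 / w ^ 2 * (m * p ^ 3 * X ^ 2) ≤ m * w := by
      rw [hw]
      have : 1 / (p * X) ^ 2 * (m * p ^ 3 * X ^ 2) = m * (p * 1) := by field_simp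
      rw [this]
      gcongr
    have h2 : (m : ℝ) / (1 / w) = m * w := by field_simp
    rw [h2]
    calc _ ≤ m * w + 16 * Real.log ((m : ℝ) + 1) * (m * w) := by gcongr
      _ = m * w * X := by rw [hX]; ring
  -- For w > 1 the threshold would be below 1, but then the allowed degree exceeds m and nothing has
  -- to be approximated.
  · refine approxDeg_of_le _ ?_ (by positivity)
    rw [hnext]
    push Not at hw1
    have : 1 ≤ w * X := by nlinarith
    nlinarith

theorem Circuit.conjTranspose_mul_toOp {m d : ℕ} (U : Circuit m d) : U.toOpᴴ * U.toOp = 1 := by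
  induction U with
  | init L => exact conjTranspose_mul_singleQubitLayer L
  | step U M L ih =>
    have hM : M.toOpᴴ * M.toOp = 1 := by
      change (czProd M.gates)ᴴ * czProd M.gates = 1
      rw [conjTranspose_czProd, czProd_mul_self]
    rw [Circuit.toOp, Matrix.conjTranspose_mul, Matrix.conjTranspose_mul]
    calc _ = U.toOpᴴ * (M.toOpᴴ * ((singleQubitLayer L)ᴴ * singleQubitLayer L) * M.toOp) *
          U.toOp := by simp only [mul_assoc]
      _ = 1 := by rw [conjTranspose_mul_singleQubitLayer, mul_one, hM, mul_one, ih]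

theorem Circuit.norm_toOp_le {m d : ℕ} (U : Circuit m d) : ‖U.toOp‖ ≤ 1 :=
  norm_le_one_of_conjTranspose_mul_self U.conjTranspose_mul_toOp

/-- In the Heisenberg picture a circuit of depth `d` raises the approximate degree in a
controlled way. -/
theorem ApproxDeg.circuit_conj {m d : ℕ} (hm : 1 ≤ m) (U : Circuit m d) {A : Op m} {j : ℕ} {e : ℝ}
    (he : 0 ≤ e) (h : ApproxDeg A (circuitDegree m j) e) (hA : ‖A‖ ≤ 1) :
    ApproxDeg (U.toOpᴴ * A * U.toOp) (circuitDegree m (j + d)) (e + d * (4 / m)) := by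
  -- In the Heisenberg picture the last layer acts on A first. It is absorbed into A before the rest
  -- of the circuit is treated, so A, j and e must vary.
  induction U generalizing A j e with
  | init L => simpa [Circuit.toOp] using h.singleQubitLayer_conj L
  | @step d U M L ih =>
    set V := singleQubitLayer L
    have hV : ‖V‖ ≤ 1 := norm_singleQubitLayer_le L
    have hV' : ‖Vᴴ‖ ≤ 1 := by rwa [Matrix.l2_opNorm_conjTranspose]
    have hA' : ‖Vᴴ * A * V‖ ≤ 1 := (norm_conj_le hV' hV).trans hA
    have h1 := (h.singleQubitLayer_conj L).czProd_conj_circuitDegree hm he hA' M.nonempty M.disjoint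
    have h2 := ih (by positivity) h1 ((norm_conj_le (norm_czProd_le M.gates)
      (norm_czProd_le M.gates)).trans hA')
    have heq : (Circuit.step U M L).toOpᴴ * A * (Circuit.step U M L).toOp =
        U.toOpᴴ * (czProd M.gates * (Vᴴ * A * V) * czProd M.gates) * U.toOp := by
      have hM : M.toOpᴴ = czProd M.gates := conjTranspose_czProd M.gates
      have hM' : M.toOp = czProd M.gates := rfl
      rw [Circuit.toOp, Matrix.conjTranspose_mul, Matrix.conjTranspose_mul, hM, hM']
      simp only [mul_assoc, V]
    rw [heq]
    refine h2.mono (le_of_eq (by rw [add_assoc, add_comm 1 d])) (le_of_eq ?_)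
    push_cast
    ring

/-! ### States and expectation values -/

/-- Write ρ as a sum of rank-one terms vv† and use |⟨v, Av⟩| ≤ ‖A‖‖v‖² for each. -/
theorem norm_trace_mul_le {m : ℕ} (A : Op m) {ρ : Op m} (hρ : ρ.PosSemidef) :
    ‖(A * ρ).trace‖ ≤ ‖A‖ * ρ.trace.re := by
  obtain ⟨r, v, rfl⟩ := Matrix.posSemidef_iff_eq_sum_vecMulVec.1 hρ
  rw [Finset.mul_sum, Matrix.trace_sum, Matrix.trace_sum, Complex.re_sum, Finset.mul_sum]
  refine (norm_sum_le _ _).trans (Finset.sum_le_sum fun i _ => ?_)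
  rw [Matrix.mul_vecMulVec, Matrix.trace_vecMulVec, Matrix.trace_vecMulVec]
  set w : EuclideanSpace ℂ (Bits m) := WithLp.toLp 2 (v i) with hw
  set z : EuclideanSpace ℂ (Bits m) := WithLp.toLp 2 (A *ᵥ v i) with hz
  have h1 : A *ᵥ v i ⬝ᵥ star (v i) = inner ℂ w z := by
    rw [EuclideanSpace.inner_eq_star_dotProduct]
  have h2 : (v i ⬝ᵥ star (v i)).re = ‖w‖ ^ 2 := by
    have : v i ⬝ᵥ star (v i) = inner ℂ w w := by
      rw [EuclideanSpace.inner_eq_star_dotProduct]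
    rw [this, ← inner_self_eq_norm_sq (𝕜 := ℂ)]
    rfl
  have h3 : ‖z‖ ≤ ‖A‖ * ‖w‖ := Matrix.l2_opNorm_mulVec A w
  rw [h1, h2]
  calc _ ≤ ‖w‖ * ‖z‖ := norm_inner_le_norm w z
    _ ≤ ‖w‖ * (‖A‖ * ‖w‖) := mul_le_mul_of_nonneg_left h3 (norm_nonneg _)
    _ = ‖A‖ * ‖w‖ ^ 2 := by ring

theorem trace_initialState {n a : ℕ} (x : Bits n) (φ : Op a) :
    (initialState x φ).trace = φ.trace := by
  rw [initialState, Matrix.trace, Matrix.trace]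
  simp only [Matrix.diag_apply, Matrix.reindex_apply, Matrix.submatrix_apply]
  rw [Equiv.sum_comp (Fin.appendEquiv n a).symm
    fun p => ((Matrix.single x x (1 : ℂ) : Op n) ⊗ₖ φ) p p]
  have := Matrix.trace_kronecker (Matrix.single x x (1 : ℂ) : Op n) φ
  rw [Matrix.trace_single_eq_same, one_mul] at this
  exact this

theorem posSemidef_initialState {n a : ℕ} (x : Bits n) {φ : Op a} (hφ : φ.PosSemidef) :
    (initialState x φ).PosSemidef := by
  have h1 : (Matrix.single x x (1 : ℂ) : Op n).PosSemidef := by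
    rw [← Matrix.diagonal_single]
    exact Matrix.PosSemidef.diagonal (Pi.single_nonneg.2 zero_le_one)
  exact (h1.kronecker hφ).submatrix _

/-- The observable `|0⟩⟨0| - |1⟩⟨1|` on the first qubit. -/
def signFirst {m : ℕ} (hm : 0 < m) : Op m :=
  Matrix.diagonal fun y => if y ⟨0, hm⟩ then -1 else 1

theorem norm_signFirst_le {m : ℕ} (hm : 0 < m) : ‖(signFirst hm : Op m)‖ ≤ 1 :=
  norm_diagonal_le zero_le_one fun y => by split_ifs <;> simp

theorem signFirst_mem_degLE {m : ℕ} (hm : 0 < m) : (signFirst hm : Op m) ∈ degLE m 1 := by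
  have h : (signFirst hm : Op m) = 1 - (2 : ℂ) • site ⟨0, hm⟩ oneProj := by
    rw [site_oneProj]
    ext y z
    simp only [signFirst, Matrix.sub_apply, Matrix.smul_apply, Matrix.one_apply,
      Matrix.diagonal_apply]
    split_ifs <;> norm_num
  have h1 : site (⟨0, hm⟩ : Fin m) oneProj ∈ degLE m 1 :=
    mem_degLE_of_mem_localOps (Finset.card_singleton _).le (site_mem_localOps ⟨0, hm⟩ oneProj)
  rw [h]
  exact sub_mem (one_mem_degLE m 1) (Submodule.smul_mem _ _ h1)

/-- The expectation `Pr[C(x) = 0] - Pr[C(x) = 1]` of the output of a circuit. -/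
noncomputable def outputMean {n a d : ℕ} (hn : 0 < n) (U : Circuit (n + a) d) (φ : Op a)
    (x : Bits n) : ℝ :=
  (U.toOpᴴ * signFirst (Nat.add_pos_left hn a) * U.toOp * initialState x φ).trace.re

theorem outputProb_eq {n a d : ℕ} (hn : 0 < n) (U : Circuit (n + a) d) {φ : Op a}
    (hφ : φ.trace = 1) (x : Bits n) (b : Bool) :
    outputProb hn U φ x b = 1 / 2 + 1 / 2 * ((if b then -1 else 1) * outputMean hn U φ x) := by
  have hM : (measureFirst (Nat.add_pos_left hn a) b : Op (n + a)) =
      (1 / 2 : ℂ) • 1 + ((1 / 2 : ℝ) * (if b then -1 else 1) : ℝ) •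
        signFirst (Nat.add_pos_left hn a) := by
    ext y z
    simp only [measureFirst, signFirst, Matrix.add_apply, Matrix.smul_apply, Matrix.one_apply,
      Matrix.diagonal_apply]
    cases b <;> cases y ⟨0, Nat.add_pos_left hn a⟩ <;> by_cases h : y = z <;> simp [h] <;> norm_num
  have h1 : (U.toOp * initialState x φ * U.toOpᴴ).trace = 1 := by
    rw [Matrix.trace_mul_comm, ← mul_assoc, U.conjTranspose_mul_toOp, one_mul, trace_initialState,
      hφ]
  have h2 : (signFirst (Nat.add_pos_left hn a) * (U.toOp * initialState x φ * U.toOpᴴ)).trace =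
      (U.toOpᴴ * signFirst (Nat.add_pos_left hn a) * U.toOp * initialState x φ).trace := by
    rw [← mul_assoc, Matrix.trace_mul_comm]
    simp only [mul_assoc]
  rw [outputProb, hM, add_mul, smul_mul_assoc, smul_mul_assoc, one_mul, Matrix.trace_add,
    Matrix.trace_smul, Matrix.trace_smul, h1, h2, Complex.add_re, outputMean]
  simp only [Complex.real_smul, Complex.re_ofReal_mul, smul_eq_mul]
  norm_num

theorem abs_outputMean_le {n a d : ℕ} (hn : 0 < n) (U : Circuit (n + a) d) {φ : Op a}
    (hφ : IsDensityOperator φ) (x : Bits n) : |outputMean hn U φ x| ≤ 1 := by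
  have hU := U.norm_toOp_le
  have hU' : ‖U.toOpᴴ‖ ≤ 1 := by rwa [Matrix.l2_opNorm_conjTranspose]
  refine (Complex.abs_re_le_norm _).trans ((norm_trace_mul_le _
    (posSemidef_initialState x hφ.posSemidef)).trans ?_)
  rw [trace_initialState, hφ.trace_eq_one, Complex.one_re, mul_one]
  exact (norm_conj_le hU' hU).trans (norm_signFirst_le _)

/-! ### Fourier analysis on the cube -/

/-- Flip the `i`-th bit. -/
def flipBit {n : ℕ} (i : Fin n) (x : Bits n) : Bits n := Function.update x i (!x i)

theorem flipBit_same {n : ℕ} (i : Fin n) (x : Bits n) : flipBit i x i = !x i := by simp [flipBit]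

theorem flipBit_of_ne {n : ℕ} {i j : Fin n} (h : j ≠ i) (x : Bits n) : flipBit i x j = x j := by
  simp [flipBit, h]

theorem flipBit_involutive {n : ℕ} (i : Fin n) : Function.Involutive (flipBit i) := fun x => by
  funext j
  by_cases h : j = i
  · subst h; simp [flipBit_same]
  · simp [flipBit_of_ne h]

theorem character_eq_prod {n : ℕ} (S : Finset (Fin n)) (x : Bits n) :
    character S x = ∏ i ∈ S, if x i then -1 else 1 := by
  rw [character, ← Finset.prod_pow_eq_pow_sum]
  refine Finset.prod_congr rfl fun i _ => ?_
  cases x i <;> simp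

theorem character_flipBit {n : ℕ} {S : Finset (Fin n)} {i : Fin n} (hi : i ∈ S) (x : Bits n) :
    character S (flipBit i x) = -character S x := by
  rw [character_eq_prod, character_eq_prod, ← Finset.mul_prod_erase S _ hi,
    ← Finset.mul_prod_erase S _ hi, flipBit_same]
  have : ∏ j ∈ S.erase i, (if flipBit i x j then (-1 : ℝ) else 1) =
      ∏ j ∈ S.erase i, (if x j then (-1 : ℝ) else 1) :=
    Finset.prod_congr rfl fun j hj => by rw [flipBit_of_ne (Finset.ne_of_mem_erase hj)]
  rw [this]
  cases x i <;> simp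

theorem character_flipBit_of_notMem {n : ℕ} {S : Finset (Fin n)} {i : Fin n} (hi : i ∉ S)
    (x : Bits n) : character S (flipBit i x) = character S x := by
  rw [character_eq_prod, character_eq_prod]
  exact Finset.prod_congr rfl fun j hj => by rw [flipBit_of_ne (ne_of_mem_of_not_mem hj hi)]

/-- The sum over S factors as a product over i of 1 + (−1)^(x_i + y_i), which vanishes at any i
where x and y differ. -/
theorem sum_character_mul_character {n : ℕ} (x y : Bits n) :
    ∑ S : Finset (Fin n), character S x * character S y = if x = y then 2 ^ n else 0 := by
  have h : ∀ S : Finset (Fin n), character S x * character S y =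
      ∏ i ∈ S, (if x i then (-1 : ℝ) else 1) * (if y i then -1 else 1) := fun S => by
    rw [character_eq_prod, character_eq_prod, Finset.prod_mul_distrib]
  simp_rw [h]
  rw [← Finset.powerset_univ, ← Finset.prod_one_add]
  split_ifs with hxy
  · subst hxy
    have : ∀ i, 1 + (if x i then (-1 : ℝ) else 1) * (if x i then -1 else 1) = 2 := fun i => by
      cases x i <;> norm_num
    rw [Finset.prod_congr rfl fun i _ => this i]
    simp
  · obtain ⟨i, hi⟩ := Function.ne_iff.1 hxy
    refine Finset.prod_eq_zero (Finset.mem_univ i) ?_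
    cases hx : x i <;> cases hy : y i <;> simp_all

/-- Plancherel's identity. -/
theorem sum_fourierCoeff_mul {n : ℕ} (f g : Bits n → ℝ) :
    ∑ S : Finset (Fin n), fourierCoeff f S * fourierCoeff g S = (∑ x, f x * g x) / 2 ^ n := by
  have h : ∀ S : Finset (Fin n), fourierCoeff f S * fourierCoeff g S =
      (∑ x, ∑ y, f x * g y * (character S x * character S y)) / (2 ^ n * 2 ^ n) := fun S => by
    rw [fourierCoeff, fourierCoeff, div_mul_div_comm, Finset.sum_mul_sum]
    congr 1
    refine Finset.sum_congr rfl fun x _ => Finset.sum_congr rfl fun y _ => by ring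
  simp_rw [h]
  rw [← Finset.sum_div, Finset.sum_comm]
  have h2 : ∀ x : Bits n, ∑ S : Finset (Fin n), ∑ y, f x * g y * (character S x * character S y) =
      f x * g x * 2 ^ n := fun x => by
    rw [Finset.sum_comm]
    simp_rw [← Finset.mul_sum, sum_character_mul_character]
    simp
  simp_rw [h2]
  rw [← Finset.sum_mul]
  field_simp

theorem sum_fourierCoeff_sq {n : ℕ} (f : Bits n → ℝ) :
    ∑ S : Finset (Fin n), fourierCoeff f S ^ 2 = (∑ x, f x ^ 2) / 2 ^ n := by
  simpa only [sq] using sum_fourierCoeff_mul f f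

theorem sum_character {n : ℕ} {S : Finset (Fin n)} (hS : S.Nonempty) :
    ∑ x, character S x = 0 := by
  obtain ⟨i, hi⟩ := hS
  have h := Equiv.sum_comp (flipBit_involutive i).toPerm fun x => character S x
  simp only [Function.Involutive.coe_toPerm, character_flipBit hi, Finset.sum_neg_distrib] at h
  linarith

/-- The sign `(-1) ^ f`. -/
def signFn {n : ℕ} (f : Bits n → Bool) (x : Bits n) : ℝ := if f x then -1 else 1

theorem signFn_sq {n : ℕ} (f : Bits n → Bool) (x : Bits n) : signFn f x ^ 2 = 1 := by
  rw [signFn]; split_ifs <;> norm_num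

/-- Since (−1)^f = 1 − 2f, the constant 1 affects only the coefficient at ∅. -/
theorem fourierCoeff_signFn {n : ℕ} (f : Bits n → Bool) {S : Finset (Fin n)} (hS : S.Nonempty) :
    fourierCoeff (signFn f) S = -2 * fourierCoeff (toReal f) S := by
  have h : ∀ x, signFn f x * character S x =
      character S x - 2 * (toReal f x * character S x) := fun x => by
    rw [signFn, toReal]; split_ifs <;> ring
  rw [fourierCoeff, fourierCoeff]
  simp_rw [h]
  rw [Finset.sum_sub_distrib, sum_character hS, ← Finset.mul_sum]
  ring

theorem sum_fourierCoeff_signFn_sq {n : ℕ} (f : Bits n → Bool) :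
    ∑ S : Finset (Fin n), fourierCoeff (signFn f) S ^ 2 = 1 := by
  rw [sum_fourierCoeff_sq]
  simp [signFn_sq]

theorem weightAbove_signFn {n : ℕ} (f : Bits n → Bool) (k : ℕ) :
    weightAbove k (signFn f) = 4 * weightAbove k (toReal f) := by
  rw [weightAbove, weightAbove, Finset.mul_sum]
  refine Finset.sum_congr rfl fun S hS => ?_
  have hS : S.Nonempty := Finset.card_pos.1 (by have := (Finset.mem_filter.1 hS).2; omega)
  rw [fourierCoeff_signFn f hS]
  ring

theorem sum_fourierCoeff_signFn_sq_low {n : ℕ} (f : Bits n → Bool) (k : ℕ) :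
    ∑ S : Finset (Fin n) with ¬ k < S.card, fourierCoeff (signFn f) S ^ 2 =
      1 - 4 * weightAbove k (toReal f) := by
  have h := Finset.sum_filter_add_sum_filter_not Finset.univ (fun S : Finset (Fin n) => k < S.card)
    fun S => fourierCoeff (signFn f) S ^ 2
  rw [sum_fourierCoeff_signFn_sq, ← weightAbove, weightAbove_signFn] at h
  linarith

/-- Functions that are close to functions of low degree correlate badly with functions that have
a large weight on the high levels. -/
theorem correlation_le {n k : ℕ} (f : Bits n → Bool) {G H : Bits n → ℝ} {ε : ℝ} (hε : 0 ≤ ε)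
    (hG : ∀ x, |G x| ≤ 1) (hGH : ∀ x, |G x - H x| ≤ ε)
    (hH : ∀ S : Finset (Fin n), k < S.card → fourierCoeff H S = 0) :
    (∑ x, signFn f x * G x) / 2 ^ n ≤ √(1 - 4 * weightAbove k (toReal f)) + 2 * ε := by
  set W := √(1 - 4 * weightAbove k (toReal f)) with hW
  have h2n : (0 : ℝ) < 2 ^ n := by positivity
  have hcard : ∀ c : ℝ, (∑ _x : Bits n, c) / 2 ^ n = c := fun c => by
    rw [Finset.sum_const, nsmul_eq_mul]
    simp
  have hs1 : ∀ x, |signFn f x| = 1 := fun x => by rw [signFn]; split_ifs <;> simp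
  have h1 : (∑ x, signFn f x * G x) / 2 ^ n ≤ (∑ x, signFn f x * H x) / 2 ^ n + ε := by
    rw [← hcard ε, ← add_div, ← Finset.sum_add_distrib]
    refine div_le_div_of_nonneg_right (Finset.sum_le_sum fun x _ => ?_) h2n.le
    have : signFn f x * (G x - H x) ≤ ε := by
      refine (le_abs_self _).trans ?_
      rw [abs_mul, hs1, one_mul]
      exact hGH x
    linarith
  have h2 : (∑ x, signFn f x * H x) / 2 ^ n =
      ∑ S : Finset (Fin n) with ¬ k < S.card, fourierCoeff (signFn f) S * fourierCoeff H S := by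
    rw [← sum_fourierCoeff_mul]
    symm
    refine Finset.sum_subset (Finset.filter_subset _ _) fun S _ hS => ?_
    simp only [Finset.mem_filter, Finset.mem_univ, true_and, not_not] at hS
    rw [hH S hS, mul_zero]
  -- By Plancherel, since |H| ≤ |G| + ε ≤ 1 + ε pointwise.
  have h3 : ∑ S : Finset (Fin n) with ¬ k < S.card, fourierCoeff H S ^ 2 ≤ (1 + ε) ^ 2 := by
    calc _ ≤ ∑ S : Finset (Fin n), fourierCoeff H S ^ 2 :=
          Finset.sum_le_sum_of_subset_of_nonneg (Finset.filter_subset _ _)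
            fun _ _ _ => sq_nonneg _
      _ = (∑ x, H x ^ 2) / 2 ^ n := sum_fourierCoeff_sq H
      _ ≤ (∑ _x : Bits n, (1 + ε) ^ 2) / 2 ^ n := by
        refine div_le_div_of_nonneg_right (Finset.sum_le_sum fun x _ => ?_) h2n.le
        rw [← sq_abs]
        refine pow_le_pow_left₀ (abs_nonneg _) ?_ 2
        have e1 := abs_le.1 (hG x)
        have e2 := abs_le.1 (hGH x)
        rw [abs_le]
        constructor <;> linarith [e1.1, e1.2, e2.1, e2.2]
      _ = (1 + ε) ^ 2 := hcard _
  have h4 := Real.sum_mul_le_sqrt_mul_sqrt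
    (Finset.univ.filter fun S : Finset (Fin n) => ¬ k < S.card)
    (fourierCoeff (signFn f)) (fourierCoeff H)
  rw [sum_fourierCoeff_signFn_sq_low, ← hW] at h4
  have h5 : √(∑ S : Finset (Fin n) with ¬ k < S.card, fourierCoeff H S ^ 2) ≤ 1 + ε :=
    Real.sqrt_le_iff.2 ⟨by linarith, h3⟩
  have hW0 : 0 ≤ W := Real.sqrt_nonneg _
  -- Turns W(1 + ε) + ε into W + 2ε.
  have hW1 : W ≤ 1 := by
    rw [hW, Real.sqrt_le_one]
    have : 0 ≤ weightAbove k (toReal f) := Finset.sum_nonneg fun _ _ => sq_nonneg _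
    linarith
  have h6 : W * √(∑ S : Finset (Fin n) with ¬ k < S.card, fourierCoeff H S ^ 2) ≤ W * (1 + ε) :=
    mul_le_mul_of_nonneg_left h5 hW0
  nlinarith

/-! ### Expectation values of low-degree observables -/

/-- The Pauli operator `X`. -/
def pauliX : Matrix Bool Bool ℂ := Matrix.of fun b c => if b = !c then 1 else 0

theorem site_pauliX_apply {m : ℕ} (i : Fin m) (y z : Bits m) :
    site i pauliX y z = if y = flipBit i z then 1 else 0 := by
  rw [site, tensor_apply]
  split_ifs with h
  · refine Finset.prod_eq_one fun j _ => ?_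
    by_cases hj : j = i
    · subst hj
      simp [pauliX, h, flipBit_same]
    · simp [Pi.mulSingle_eq_of_ne hj, h, flipBit_of_ne hj]
  · obtain ⟨j, hj⟩ := Function.ne_iff.1 h
    refine Finset.prod_eq_zero (Finset.mem_univ j) ?_
    by_cases hji : j = i
    · subst hji
      rw [flipBit_same] at hj
      simp [pauliX, hj]
    · rw [flipBit_of_ne hji] at hj
      simp [Pi.mulSingle_eq_of_ne hji, hj]

theorem site_pauliX_mul_apply {m : ℕ} (i : Fin m) (A : Op m) (y z : Bits m) :
    (site i pauliX * A) y z = A (flipBit i y) z := by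
  rw [Matrix.mul_apply, Finset.sum_eq_single (flipBit i y)]
  · rw [site_pauliX_apply, flipBit_involutive i y, if_pos rfl, one_mul]
  · intro w _ hw
    rw [site_pauliX_apply, if_neg, zero_mul]
    rintro rfl
    exact hw (flipBit_involutive i w).symm
  · simp

theorem mul_site_pauliX_apply {m : ℕ} (i : Fin m) (A : Op m) (y z : Bits m) :
    (A * site i pauliX) y z = A y (flipBit i z) := by
  rw [Matrix.mul_apply, Finset.sum_eq_single (flipBit i z)]
  · rw [site_pauliX_apply, if_pos rfl, mul_one]
  · intro w _ hw
    rw [site_pauliX_apply, if_neg hw, mul_zero]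
  · simp

theorem site_pauliX_mul_self {m : ℕ} (i : Fin m) :
    site i pauliX * site i pauliX = (1 : Op m) := by
  ext y z
  simp only [site_pauliX_mul_apply, site_pauliX_apply, (flipBit_involutive i).injective.eq_iff,
    Matrix.one_apply]

theorem initialState_apply {n a : ℕ} (x : Bits n) (φ : Op a) (y z : Bits (n + a)) :
    initialState x φ y z =
      (if x = (fun j => y (Fin.castAdd a j)) ∧ x = (fun j => z (Fin.castAdd a j)) then 1 else 0) *
        φ (fun j => y (Fin.natAdd n j)) (fun j => z (Fin.natAdd n j)) := by
  rw [initialState, Matrix.reindex_apply, Matrix.submatrix_apply, Matrix.kroneckerMap_apply,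
    Matrix.single_apply]
  rfl

theorem flipBit_castAdd {n a : ℕ} (i : Fin n) (y : Bits (n + a)) :
    (fun j => flipBit (Fin.castAdd a i) y (Fin.castAdd a j)) =
      flipBit i fun j => y (Fin.castAdd a j) := by
  funext j
  by_cases h : j = i
  · subst h; simp [flipBit_same]
  · rw [flipBit_of_ne h, flipBit_of_ne fun h' => h (Fin.castAdd_injective n a h')]

theorem flipBit_natAdd {n a : ℕ} (i : Fin n) (y : Bits (n + a)) :
    (fun j => flipBit (Fin.castAdd a i) y (Fin.natAdd n j)) = fun j => y (Fin.natAdd n j) := by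
  funext j
  refine flipBit_of_ne (fun h => ?_) y
  have := congrArg Fin.val h
  simp at this
  omega

theorem site_pauliX_mul_initialState {n a : ℕ} (i : Fin n) (x : Bits n) (φ : Op a) :
    site (Fin.castAdd a i) pauliX * initialState x φ =
      initialState (flipBit i x) φ * site (Fin.castAdd a i) pauliX := by
  ext y z
  have h : ∀ w : Bits n, x = flipBit i w ↔ flipBit i x = w := fun w =>
    ⟨fun h => by rw [h, flipBit_involutive i w], fun h => by rw [← h, flipBit_involutive i x]⟩
  simp only [site_pauliX_mul_apply, mul_site_pauliX_apply, initialState_apply, flipBit_castAdd,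
    flipBit_natAdd, h, (flipBit_involutive i).injective.eq_iff]

/-- Flipping input bit i conjugates the initial state by X on qubit i. This X commutes with B, so it
cancels under the trace. -/
theorem trace_mul_initialState_flipBit {n a : ℕ} {T : Finset (Fin (n + a))} {i : Fin n}
    (hi : Fin.castAdd a i ∉ T) {B : Op (n + a)} (hB : B ∈ localOps T) (φ : Op a) (x : Bits n) :
    (B * initialState (flipBit i x) φ).trace = (B * initialState x φ).trace := by
  set X : Op (n + a) := site (Fin.castAdd a i) pauliX with hX
  have h1 : X * B = B * X := mem_localOps.1 hB _ hi _
  have h2 : initialState (flipBit i x) φ = X * initialState x φ * X := by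
    rw [hX, site_pauliX_mul_initialState, mul_assoc, site_pauliX_mul_self, mul_one]
  rw [h2, ← mul_assoc, ← mul_assoc, Matrix.trace_mul_comm, ← h1, ← mul_assoc, ← mul_assoc,
    site_pauliX_mul_self, one_mul]

/-- Transfers operator degree to Fourier degree: a set S of more than k inputs contains an i outside
the support of a k-local term. Flipping x_i fixes the trace and negates the character. -/
theorem sum_trace_mul_character {n a k : ℕ} {B : Op (n + a)} (hB : B ∈ degLE (n + a) k)
    (φ : Op a) {S : Finset (Fin n)} (hS : k < S.card) :
    ∑ x, (B * initialState x φ).trace * (character S x : ℂ) = 0 := by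
  induction hB using Submodule.span_induction with
  | mem B hB =>
    obtain ⟨T, hT, hB⟩ := hB
    obtain ⟨i, hiS, hiT⟩ : ∃ i ∈ S, Fin.castAdd a i ∉ T := by
      by_contra hcon
      push Not at hcon
      have := Finset.card_le_card_of_injOn (Fin.castAdd a) hcon
        (Fin.castAdd_injective n a).injOn
      omega
    have h := Equiv.sum_comp (flipBit_involutive i).toPerm
      fun x => (B * initialState x φ).trace * (character S x : ℂ)
    simp only [Function.Involutive.coe_toPerm, character_flipBit hiS,
      trace_mul_initialState_flipBit hiT hB, Complex.ofReal_neg, mul_neg,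
      Finset.sum_neg_distrib] at h
    exact self_eq_neg.1 h.symm
  | zero => simp
  | add B B' _ _ ih ih' =>
    simp only [add_mul, Matrix.trace_add, Finset.sum_add_distrib, ih, ih', add_zero]
  | smul c B _ ih =>
    simp only [smul_mul_assoc, Matrix.trace_smul, smul_eq_mul, mul_assoc, ← Finset.mul_sum, ih,
      mul_zero]

theorem fourierCoeff_re_trace {n a k : ℕ} {B : Op (n + a)} (hB : B ∈ degLE (n + a) k)
    (φ : Op a) {S : Finset (Fin n)} (hS : k < S.card) :
    fourierCoeff (fun x => (B * initialState x φ).trace.re) S = 0 := by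
  have h := congrArg Complex.re (sum_trace_mul_character hB φ hS)
  rw [Complex.re_sum] at h
  simp only [Complex.re_mul_ofReal, Complex.zero_re] at h
  rw [fourierCoeff, h, zero_div]

theorem successProb_eq {n a d : ℕ} (hn : 0 < n) (U : Circuit (n + a) d) {φ : Op a}
    (hφ : φ.trace = 1) (f : Bits n → Bool) :
    successProb hn U φ f = 1 / 2 + 1 / 2 * ((∑ x, signFn f x * outputMean hn U φ x) / 2 ^ n) := by
  rw [successProb]
  simp_rw [outputProb_eq hn U hφ, ← signFn.eq_1]
  rw [Finset.sum_add_distrib, Finset.sum_const, ← Finset.mul_sum, nsmul_eq_mul, add_div]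
  simp
  ring

/-- The common source of all three bounds. The approximation error ε = 4d/m enters the correlation
as 2ε and is halved in the success probability. -/
theorem successProb_le_of_circuitDegree_le {n a d k : ℕ} (hn : 0 < n) (U : Circuit (n + a) d)
    {φ : Op a} (hφ : IsDensityOperator φ) (f : Bits n → Bool)
    (hk : circuitDegree (n + a) d ≤ k) :
    successProb hn U φ f ≤
      1 / 2 + 1 / 2 * √(1 - 4 * weightAbove k (toReal f)) + 4 * (d / n) := by
  have hm : 1 ≤ n + a := Nat.add_pos_left hn a
  have h0 : ApproxDeg (signFirst hm) (circuitDegree (n + a) 0) 0 := by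
    refine ⟨signFirst hm, 1, ?_, signFirst_mem_degLE hm, by simp⟩
    have := half_le_log_succ hm
    rw [circuitDegree, pow_zero, div_one, sub_self, Real.rpow_zero, one_mul, Nat.cast_one,
      one_le_sq_iff₀ (by linarith)]
    linarith
  obtain ⟨B, j, hj, hB, hBε⟩ := h0.circuit_conj hm U le_rfl (norm_signFirst_le hm)
  rw [zero_add] at hj hBε
  have hjk : j ≤ k := by exact_mod_cast hj.trans hk
  have hcorr := correlation_le (k := k) f (G := outputMean hn U φ)
    (H := fun x => (B * initialState x φ).trace.re)
    (ε := d * (4 / (n + a : ℕ))) (by positivity) (abs_outputMean_le hn U hφ) (fun x => by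
      rw [outputMean, ← Complex.sub_re, ← Matrix.trace_sub, ← sub_mul]
      refine (Complex.abs_re_le_norm _).trans ((norm_trace_mul_le _
        (posSemidef_initialState x hφ.posSemidef)).trans ?_)
      rw [trace_initialState, hφ.trace_eq_one, Complex.one_re, mul_one]
      exact hBε)
    fun S hS => fourierCoeff_re_trace (degLE_mono hjk hB) φ hS
  rw [successProb_eq hn U hφ.trace_eq_one]
  have hn0 : (0 : ℝ) < n := by exact_mod_cast hn
  have hε : (d : ℝ) * (4 / (n + a : ℕ)) ≤ 4 * (d / n) := by
    calc (d : ℝ) * (4 / (n + a : ℕ)) ≤ d * (4 / n) := by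
          push_cast
          gcongr
          linarith [Nat.cast_nonneg (α := ℝ) a]
      _ = 4 * (d / n) := by ring
  linarith

theorem circuitDegree_le {n a : ℕ} (hn : 0 < n) (d : ℕ) :
    circuitDegree (n + a) d ≤
      324 * ((n : ℝ) + a) ^ (1 - 1 / (3 : ℝ) ^ d) * Real.log ((n : ℝ) + a + 1) ^ 2 := by
  have hl := half_le_log_succ (Nat.add_pos_left hn a : 1 ≤ n + a)
  push_cast at hl
  rw [circuitDegree]
  push_cast
  have hp : 0 ≤ ((n : ℝ) + a) ^ (1 - 1 / (3 : ℝ) ^ d) := Real.rpow_nonneg (by positivity) _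
  -- The logarithm is at least 1/2, so 1 is absorbed as twice the logarithm; 324 = 18².
  have : (1 + 16 * Real.log ((n : ℝ) + a + 1)) ^ 2 ≤ (18 * Real.log ((n : ℝ) + a + 1)) ^ 2 :=
    pow_le_pow_left₀ (by linarith) (by linarith) 2
  nlinarith [mul_le_mul_of_nonneg_left this hp]

open Filter Asymptotics

/-! ### Growth of the degree -/

theorem eventually_log_pow_le (β : ℕ) {c δ : ℝ} (hc : 0 < c) (hδ : 0 < δ) :
    ∀ᶠ n : ℕ in atTop, Real.log n ^ β ≤ c * (n : ℝ) ^ δ := by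
  have h := (isLittleO_log_rpow_rpow_atTop (β : ℝ) hδ).def hc
  filter_upwards [tendsto_natCast_atTop_atTop.eventually h] with n hn
  have h1 := (le_abs_self _).trans hn
  rwa [Real.rpow_natCast, Real.norm_eq_abs,
    abs_of_nonneg (Real.rpow_nonneg (Nat.cast_nonneg n) δ)] at h1

theorem exists_circuitDegree_le (d : ℕ) (B : ℝ) (β : ℕ) {c : ℝ} (hc : 0 < c) :
    ∃ n₀ : ℕ, ∀ n a : ℕ, n₀ ≤ n →
      (a : ℝ) ≤ B * (n : ℝ) ^ (1 + 1 / (3 : ℝ) ^ d) * Real.log n ^ β →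
      circuitDegree (n + a) d ≤ c * n := by
  set t : ℝ := 1 / (3 : ℝ) ^ d with ht
  have ht0 : 0 < t := by positivity
  have ht1 : t ≤ 1 := by
    rw [ht, div_le_one (by positivity)]
    exact one_le_pow₀ (by norm_num)
  -- Half of the gain in (1 + t)(1 − t) = 1 − t². One n^δ absorbs the logarithms in the bound on a,
  -- and the remaining n^(−δ) absorbs those in the degree.
  set δ : ℝ := t ^ 2 / 2 with hδ
  have hδ0 : 0 < δ := by positivity
  have hδ1 : δ ≤ 1 := by nlinarith
  have hB : 0 < 1 + |B| := by positivity
  have e1 := eventually_log_pow_le β (c := 1 / (1 + |B|)) (by positivity) hδ0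
  have e2 := eventually_log_pow_le 2 (c := c / 65 ^ 2) (by positivity) hδ0
  obtain ⟨n₀, hn₀⟩ := eventually_atTop.1 (e1.and (e2.and (eventually_ge_atTop 3)))
  refine ⟨n₀, fun n a hn ha => ?_⟩
  obtain ⟨h1, h2, h3⟩ := hn₀ n hn
  have hn3 : (3 : ℝ) ≤ n := by exact_mod_cast h3
  have hn0 : (0 : ℝ) < n := by linarith
  have hn1 : (1 : ℝ) ≤ n := by linarith
  have hlog : 1 ≤ Real.log n := by
    rw [Real.le_log_iff_exp_le hn0]
    have := Real.exp_one_lt_d9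
    linarith
  have hlogβ : 1 ≤ Real.log n ^ β := one_le_pow₀ hlog
  have hm : (n : ℝ) + a ≤ (n : ℝ) ^ (1 + t + δ) := by
    have hnt : (n : ℝ) ≤ (n : ℝ) ^ (1 + t) * Real.log n ^ β := by
      calc (n : ℝ) = (n : ℝ) ^ (1 : ℝ) * 1 := by rw [Real.rpow_one, mul_one]
        _ ≤ (n : ℝ) ^ (1 + t) * Real.log n ^ β :=
          mul_le_mul (Real.rpow_le_rpow_of_exponent_le hn1 (by linarith)) hlogβ zero_le_one
            (Real.rpow_nonneg hn0.le _)
    have h0 : 0 ≤ (n : ℝ) ^ (1 + t) := Real.rpow_nonneg hn0.le _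
    have h4 : (1 + |B|) * Real.log n ^ β ≤ (n : ℝ) ^ δ := by
      rwa [one_div, inv_mul_eq_div, le_div_iff₀ hB, mul_comm] at h1
    have h5 : (a : ℝ) ≤ |B| * ((n : ℝ) ^ (1 + t) * Real.log n ^ β) := by
      rw [mul_assoc] at ha
      exact ha.trans (mul_le_mul_of_nonneg_right (le_abs_self B) (by positivity))
    calc (n : ℝ) + a ≤ (n : ℝ) ^ (1 + t) * ((1 + |B|) * Real.log n ^ β) := by linarith
      _ ≤ (n : ℝ) ^ (1 + t) * (n : ℝ) ^ δ := mul_le_mul_of_nonneg_left h4 h0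
      _ = (n : ℝ) ^ (1 + t + δ) := by rw [← Real.rpow_add hn0]
  have hm1 : (n : ℝ) + a + 1 ≤ (n : ℝ) ^ 4 := by
    have h4 : (n : ℝ) ^ (1 + t + δ) ≤ (n : ℝ) ^ (3 : ℝ) :=
      Real.rpow_le_rpow_of_exponent_le hn1 (by linarith)
    have h5 : (n : ℝ) ^ (3 : ℝ) = (n : ℝ) ^ 3 := by exact_mod_cast Real.rpow_natCast (n : ℝ) 3
    have h6 : (1 : ℝ) ≤ (n : ℝ) ^ 3 := one_le_pow₀ hn1
    have h7 : (n : ℝ) ^ 4 = n * (n : ℝ) ^ 3 := by ring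
    have h8 := mul_le_mul_of_nonneg_right hn3 (zero_le_one.trans h6)
    rw [h5] at h4
    linarith
  have hm2 : Real.log ((n : ℝ) + a + 1) ≤ 4 * Real.log n := by
    have := Real.log_le_log (by positivity) hm1
    rwa [Real.log_pow, Nat.cast_ofNat] at this
  have hlog0 : 0 ≤ Real.log ((n : ℝ) + a + 1) :=
    Real.log_nonneg (by linarith [Nat.cast_nonneg (α := ℝ) a])
  -- The constant is 65 = 1 + 16 · 4, from log(n + a + 1) ≤ 4 log n and log n ≥ 1.
  have hX : (1 + 16 * Real.log ((n : ℝ) + a + 1)) ^ 2 ≤ c * (n : ℝ) ^ δ :=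
    calc _ ≤ (65 * Real.log n) ^ 2 := pow_le_pow_left₀ (by linarith) (by linarith) 2
      _ = 65 ^ 2 * Real.log n ^ 2 := by ring
      _ ≤ 65 ^ 2 * (c / 65 ^ 2 * (n : ℝ) ^ δ) := by gcongr
      _ = c * (n : ℝ) ^ δ := by ring
  have hpow : ((n : ℝ) + a) ^ (1 - t) ≤ (n : ℝ) ^ (1 - δ) := by
    calc ((n : ℝ) + a) ^ (1 - t) ≤ ((n : ℝ) ^ (1 + t + δ)) ^ (1 - t) :=
          Real.rpow_le_rpow (by positivity) hm (by linarith)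
      _ = (n : ℝ) ^ ((1 + t + δ) * (1 - t)) := by rw [← Real.rpow_mul hn0.le]
      _ ≤ (n : ℝ) ^ (1 - δ) := by
        refine Real.rpow_le_rpow_of_exponent_le hn1 ?_
        have : t ^ 2 = 2 * δ := by rw [hδ]; ring
        nlinarith
  rw [circuitDegree]
  push_cast
  calc _ ≤ (n : ℝ) ^ (1 - δ) * (c * (n : ℝ) ^ δ) :=
        mul_le_mul hpow hX (sq_nonneg _) (Real.rpow_nonneg hn0.le _)
    _ = c * ((n : ℝ) ^ (1 - δ) * (n : ℝ) ^ δ) := by ring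
    _ = c * n := by rw [← Real.rpow_add hn0]; simp

theorem four_mul_weightAbove_le_one {n : ℕ} (f : Bits n → Bool) (k : ℕ) :
    4 * weightAbove k (toReal f) ≤ 1 := by
  rw [← weightAbove_signFn, ← sum_fourierCoeff_signFn_sq f]
  exact Finset.sum_le_sum_of_subset_of_nonneg (Finset.filter_subset _ _) fun _ _ _ => sq_nonneg _

/-! ### Parity -/

theorem signFn_parity {n : ℕ} (x : Bits n) : signFn (parity n) x = character Finset.univ x := by
  rw [character, ← hammingWeight]
  simp only [signFn, parity, decide_eq_true_eq]
  split_ifs with h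
  · exact (Odd.neg_one_pow (Nat.odd_iff.2 h)).symm
  · exact (Even.neg_one_pow (Nat.even_iff.2 (by omega))).symm

/-- The sign of parity is the character of the full set, so all its weight sits on level n. -/
theorem one_le_four_mul_weightAbove_parity {n k : ℕ} (hk : k < n) :
    1 ≤ 4 * weightAbove k (toReal (parity n)) := by
  rw [← weightAbove_signFn, weightAbove]
  have h1 : fourierCoeff (signFn (parity n)) Finset.univ = 1 := by
    rw [fourierCoeff]
    simp_rw [← signFn_parity, ← sq, signFn_sq]
    simp
  calc (1 : ℝ) = fourierCoeff (signFn (parity n)) Finset.univ ^ 2 := by rw [h1, one_pow]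
    _ ≤ _ := Finset.single_le_sum (f := fun S => fourierCoeff (signFn (parity n)) S ^ 2)
      (fun _ _ => sq_nonneg _) (by simpa using hk)

/-! ### Majority -/

/-- The Laplacian on the cube. -/
noncomputable def laplacian {n : ℕ} (f : Bits n → ℝ) (x : Bits n) : ℝ :=
  ∑ i, (f x - f (flipBit i x)) / 2

/-- The i-th term is the projection onto the characters containing i, so a set S is counted |S|
times. -/
theorem fourierCoeff_laplacian {n : ℕ} (f : Bits n → ℝ) (S : Finset (Fin n)) :
    fourierCoeff (laplacian f) S = S.card * fourierCoeff f S := by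
  have h : ∀ i, ∑ x, (f x - f (flipBit i x)) / 2 * character S x =
      if i ∈ S then ∑ x, f x * character S x else 0 := fun i => by
    have h1 := Equiv.sum_comp (flipBit_involutive i).toPerm
      fun x => f (flipBit i x) * character S x
    simp only [Function.Involutive.coe_toPerm, flipBit_involutive i _] at h1
    have h2 : ∑ x, (f x - f (flipBit i x)) / 2 * character S x =
        (∑ x, f x * character S x - ∑ x, f (flipBit i x) * character S x) / 2 := by
      rw [← Finset.sum_sub_distrib, Finset.sum_div]
      exact Finset.sum_congr rfl fun x _ => by ring
    rw [h2, ← h1]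
    split_ifs with hi
    · simp_rw [character_flipBit hi, mul_neg, Finset.sum_neg_distrib]
      ring
    · simp_rw [character_flipBit_of_notMem hi]
      simp
  rw [fourierCoeff, fourierCoeff]
  simp_rw [laplacian, Finset.sum_mul]
  rw [Finset.sum_comm]
  simp_rw [h]
  rw [← Finset.sum_filter, Finset.filter_mem_eq_inter, Finset.univ_inter, Finset.sum_const,
    nsmul_eq_mul, mul_div_assoc]

theorem hammingWeight_flipBit {n : ℕ} (i : Fin n) (x : Bits n) :
    hammingWeight (flipBit i x) + (x i).toNat = hammingWeight x + (!x i).toNat := by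
  rw [hammingWeight, hammingWeight, ← Finset.add_sum_erase _ _ (Finset.mem_univ i),
    ← Finset.add_sum_erase (f := fun j => (x j).toNat) _ (Finset.mem_univ i), flipBit_same]
  have : ∑ j ∈ Finset.univ.erase i, (flipBit i x j).toNat =
      ∑ j ∈ Finset.univ.erase i, (x j).toNat :=
    Finset.sum_congr rfl fun j hj => by rw [flipBit_of_ne (Finset.ne_of_mem_erase hj)]
  rw [this]
  ring

theorem sum_ite_eq_hammingWeight {n : ℕ} (x : Bits n) :
    ∑ i, (if x i then (1 : ℝ) else 0) = hammingWeight x := by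
  rw [hammingWeight, Nat.cast_sum]
  exact Finset.sum_congr rfl fun i _ => by cases x i <;> simp

/-- The indicator function of the two middle layers of the cube. -/
def middle {n : ℕ} (p : ℕ) (x : Bits n) : ℝ :=
  if hammingWeight x = p ∨ hammingWeight x = p + 1 then 1 else 0

/-- Only strings in the two middle layers have pivotal bits, and each has exactly p + 1: its zeros
at weight p, its ones at weight p + 1. -/
theorem laplacian_signFn_majority {p : ℕ} (x : Bits (2 * p + 1)) :
    laplacian (signFn (majority (2 * p + 1))) x =
      signFn (majority (2 * p + 1)) x * ((p + 1) * middle p x) := by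
  have hm : ∀ y : Bits (2 * p + 1), signFn (majority (2 * p + 1)) y =
      if p + 1 ≤ hammingWeight y then -1 else 1 := fun y => by
    simp only [signFn, majority, decide_eq_true_eq]
    refine if_congr ?_ rfl rfl
    omega
  have hflip : ∀ i, x i = true → hammingWeight (flipBit i x) + 1 = hammingWeight x := fun i hi => by
    simpa [hi] using hammingWeight_flipBit i x
  have hflip' : ∀ i, x i = false → hammingWeight (flipBit i x) = hammingWeight x + 1 :=
    fun i hi => by simpa [hi] using hammingWeight_flipBit i x
  rw [laplacian, middle]
  simp_rw [hm]
  by_cases h1 : hammingWeight x = p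
  · have h : ∀ i, ((if p + 1 ≤ hammingWeight x then (-1 : ℝ) else 1) -
        if p + 1 ≤ hammingWeight (flipBit i x) then -1 else 1) / 2 =
        1 - if x i then 1 else 0 := fun i => by
      cases hi : x i
      · rw [if_neg (by omega), if_pos (by have := hflip' i hi; omega)]; norm_num
      · rw [if_neg (by omega), if_neg (by have := hflip i hi; omega)]; norm_num
    simp_rw [h]
    rw [Finset.sum_sub_distrib, sum_ite_eq_hammingWeight, if_neg (by omega), if_pos (Or.inl h1), h1]
    simp
    ring
  · by_cases h2 : hammingWeight x = p + 1
    · have h : ∀ i, ((if p + 1 ≤ hammingWeight x then (-1 : ℝ) else 1) -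
          if p + 1 ≤ hammingWeight (flipBit i x) then -1 else 1) / 2 =
          -if x i then 1 else 0 := fun i => by
        cases hi : x i
        · rw [if_pos (by omega), if_pos (by have := hflip' i hi; omega)]; norm_num
        · rw [if_pos (by omega), if_neg (by have := hflip i hi; omega)]; norm_num
      simp_rw [h]
      rw [Finset.sum_neg_distrib, sum_ite_eq_hammingWeight, if_pos (by omega), if_pos (Or.inr h2),
        h2]
      push_cast
      ring
    · have h : ∀ i, ((if p + 1 ≤ hammingWeight x then (-1 : ℝ) else 1) -
          if p + 1 ≤ hammingWeight (flipBit i x) then -1 else 1) / 2 = 0 := fun i => by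
        have : p + 1 ≤ hammingWeight (flipBit i x) ↔ p + 1 ≤ hammingWeight x := by
          cases hi : x i
          · have := hflip' i hi; omega
          · have := hflip i hi; omega
        simp [this]
      simp_rw [h]
      rw [if_neg (c := _ ∨ _) (by tauto)]
      simp

theorem sixteen_pow_le_centralBinom_sq (p : ℕ) : 16 ^ p ≤ (4 * p + 1) * p.centralBinom ^ 2 := by
  induction p with
  | zero => simp
  | succ p ih =>
    have h := Nat.succ_mul_centralBinom_succ p
    have h2 : (p + 1) ^ 2 * 16 ^ (p + 1) ≤
        (p + 1) ^ 2 * ((4 * (p + 1) + 1) * (p + 1).centralBinom ^ 2) :=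
      calc (p + 1) ^ 2 * 16 ^ (p + 1) = 16 * (p + 1) ^ 2 * 16 ^ p := by ring
        _ ≤ 16 * (p + 1) ^ 2 * ((4 * p + 1) * p.centralBinom ^ 2) := Nat.mul_le_mul_left _ ih
        _ ≤ (4 * (p + 1) + 1) * (2 * (2 * p + 1) * p.centralBinom) ^ 2 := by
          -- After expansion the two cubics differ by exactly 1.
          have : 4 * ((p + 1) ^ 2 * (4 * p + 1)) ≤ (4 * (p + 1) + 1) * (2 * p + 1) ^ 2 := by
            ring_nf; omega
          calc _ = 4 * p.centralBinom ^ 2 * (4 * ((p + 1) ^ 2 * (4 * p + 1))) := by ring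
            _ ≤ 4 * p.centralBinom ^ 2 * ((4 * (p + 1) + 1) * (2 * p + 1) ^ 2) :=
              Nat.mul_le_mul_left _ this
            _ = _ := by ring
        _ = (p + 1) ^ 2 * ((4 * (p + 1) + 1) * (p + 1).centralBinom ^ 2) := by rw [← h]; ring
    exact Nat.le_of_mul_le_mul_left h2 (by positivity)

theorem choose_le_card_hammingWeight_eq (n p : ℕ) :
    n.choose p ≤ (Finset.univ.filter fun x : Bits n => hammingWeight x = p).card := by
  have h : (Finset.powersetCard p (Finset.univ : Finset (Fin n))).card = n.choose p := by
    rw [Finset.card_powersetCard, Finset.card_univ, Fintype.card_fin]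
  rw [← h]
  refine Finset.card_le_card_of_injOn (fun S i => decide (i ∈ S)) (fun S hS => ?_)
    fun S _ S' _ hSS' => ?_
  · have hS := (Finset.mem_powersetCard.1 hS).2
    refine Finset.mem_filter.2 ⟨Finset.mem_univ _, ?_⟩
    have : ∀ i, (decide (i ∈ S)).toNat = if i ∈ S then 1 else 0 := fun i => by
      by_cases hi : i ∈ S <;> simp [hi]
    simp only [hammingWeight, this]
    simpa using hS
  · ext i
    simpa using congrFun hSS' i

/-- Layer p alone suffices: its size is at least the central binomial coefficient of p, which is at
least 4^p/(2√(2p + 1)). -/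
theorem le_mean_middle (p : ℕ) :
    1 / (4 * √((2 * p + 1 : ℕ) : ℝ)) ≤ (∑ x : Bits (2 * p + 1), middle p x) / 2 ^ (2 * p + 1) := by
  have h1 : (p.centralBinom : ℝ) ≤ ∑ x : Bits (2 * p + 1), middle p x := by
    have h2 : p.centralBinom ≤ (2 * p + 1).choose p := by
      rw [Nat.centralBinom_eq_two_mul_choose]
      exact Nat.choose_le_choose p (Nat.le_succ _)
    calc (p.centralBinom : ℝ) ≤
          ((Finset.univ.filter fun x : Bits (2 * p + 1) => hammingWeight x = p).card : ℝ) := by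
          exact_mod_cast h2.trans (choose_le_card_hammingWeight_eq _ p)
      _ = ∑ x : Bits (2 * p + 1), if hammingWeight x = p then 1 else 0 := by simp
      _ ≤ _ := Finset.sum_le_sum fun x _ => by
        rw [middle]
        by_cases h : hammingWeight x = p
        · simp [h]
        · rw [if_neg h]; split_ifs <;> norm_num
  have h2 : (16 : ℝ) ^ p ≤ (4 * p + 1) * (p.centralBinom : ℝ) ^ 2 := by
    exact_mod_cast sixteen_pow_le_centralBinom_sq p
  set s := √((2 * p + 1 : ℕ) : ℝ) with hs
  have hs2 : s ^ 2 = 2 * p + 1 := by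
    rw [hs, Real.sq_sqrt (Nat.cast_nonneg _)]
    push_cast
    rfl
  have hs0 : 0 < s := Real.sqrt_pos.2 (by positivity)
  have h3 : (4 : ℝ) ^ p ≤ 2 * s * p.centralBinom := by
    refine (pow_le_pow_iff_left₀ (by positivity) (by positivity) two_ne_zero).1 ?_
    calc ((4 : ℝ) ^ p) ^ 2 = 16 ^ p := by rw [← pow_mul, mul_comm, pow_mul]; norm_num
      _ ≤ (4 * p + 1) * (p.centralBinom : ℝ) ^ 2 := h2
      _ ≤ 4 * (2 * p + 1) * (p.centralBinom : ℝ) ^ 2 := by gcongr; linarith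
      _ = (2 * s * p.centralBinom) ^ 2 := by rw [← hs2]; ring
  rw [div_le_div_iff₀ (by positivity) (by positivity), one_mul, pow_succ, pow_mul]
  norm_num
  nlinarith

/-- Pairing the Laplacian of F with F and with itself shows that |S| has first moment (p + 1)P and
second moment (p + 1)²P under the weights of F. Levels up to k ≤ (p + 1)/2 account for at most half
of the second moment; the rest must lie above k. -/
theorem mean_middle_le_weightAbove {p k : ℕ} (hk : 2 * k ≤ p + 1) :
    (∑ x : Bits (2 * p + 1), middle p x) / 2 ^ (2 * p + 1) ≤
      8 * weightAbove k (signFn (majority (2 * p + 1))) := by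
  set F := signFn (majority (2 * p + 1)) with hF
  set P := (∑ x : Bits (2 * p + 1), middle p x) / 2 ^ (2 * p + 1) with hP
  have hlap : ∀ x, laplacian F x = F x * ((p + 1) * middle p x) := laplacian_signFn_majority
  have hmid : ∀ x : Bits (2 * p + 1), middle p x * middle p x = middle p x := fun x => by
    rw [middle]; split_ifs <;> norm_num
  have h1 : ∑ S : Finset (Fin (2 * p + 1)), (S.card : ℝ) * fourierCoeff F S ^ 2 = (p + 1) * P := by
    have h := sum_fourierCoeff_mul F (laplacian F)
    simp_rw [fourierCoeff_laplacian, hlap] at h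
    have e : ∀ x, F x * (F x * ((p + 1) * middle p x)) = (p + 1) * middle p x := fun x => by
      rw [← mul_assoc, ← sq, hF, signFn_sq, one_mul]
    simp_rw [e] at h
    rw [← Finset.mul_sum, mul_div_assoc, ← hP] at h
    rw [← h]
    exact Finset.sum_congr rfl fun S _ => by ring
  have h2 : ∑ S : Finset (Fin (2 * p + 1)), (S.card : ℝ) ^ 2 * fourierCoeff F S ^ 2 =
      (p + 1) ^ 2 * P := by
    have h := sum_fourierCoeff_sq (laplacian F)
    simp_rw [fourierCoeff_laplacian, hlap] at h
    have e : ∀ x, (F x * ((p + 1) * middle p x)) ^ 2 = (p + 1) ^ 2 * middle p x := fun x => by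
      rw [mul_pow, hF, signFn_sq, one_mul, mul_pow, sq (middle p x), hmid]
    simp_rw [e, mul_pow] at h
    rwa [← Finset.mul_sum, mul_div_assoc, ← hP] at h
  -- On low levels |S|² ≤ k|S|; on high levels |S| ≤ 2(p + 1).
  have h3 : ∑ S : Finset (Fin (2 * p + 1)), (S.card : ℝ) ^ 2 * fourierCoeff F S ^ 2 ≤
      ∑ S : Finset (Fin (2 * p + 1)), k * (S.card * fourierCoeff F S ^ 2) +
        (2 * (p + 1)) ^ 2 * weightAbove k F := by
    rw [weightAbove, Finset.sum_filter, Finset.mul_sum, ← Finset.sum_add_distrib]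
    refine Finset.sum_le_sum fun S _ => ?_
    have hc : (S.card : ℝ) ≤ 2 * (p + 1) := by
      have := S.card_le_univ
      rw [Fintype.card_fin] at this
      have : (S.card : ℝ) ≤ 2 * p + 1 := by exact_mod_cast this
      linarith
    have hc0 : (0 : ℝ) ≤ S.card := Nat.cast_nonneg _
    have hq := sq_nonneg (fourierCoeff F S)
    split_ifs with hS
    · have e1 : (S.card : ℝ) ^ 2 * fourierCoeff F S ^ 2 ≤
          (2 * (p + 1)) ^ 2 * fourierCoeff F S ^ 2 := by gcongr
      have e2 : 0 ≤ (k : ℝ) * (S.card * fourierCoeff F S ^ 2) := by positivity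
      linarith
    · have hk' : (S.card : ℝ) ≤ k := by exact_mod_cast not_lt.1 hS
      have e1 := mul_le_mul_of_nonneg_right hk' (mul_nonneg hc0 hq)
      rw [mul_zero, add_zero]
      calc _ = (S.card : ℝ) * (S.card * fourierCoeff F S ^ 2) := by ring
        _ ≤ _ := e1
  rw [← Finset.mul_sum, h1, h2] at h3
  have hP0 : 0 ≤ P := div_nonneg (Finset.sum_nonneg fun x _ => by
    rw [middle]; split_ifs <;> norm_num) (by positivity)
  have hk' : 2 * (k : ℝ) ≤ p + 1 := by exact_mod_cast hk
  have hp : (0 : ℝ) < p + 1 := by positivity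
  have h4 : (k : ℝ) * ((p + 1) * P) ≤ (p + 1) ^ 2 / 2 * P := by
    have := mul_le_mul_of_nonneg_right hk' (mul_nonneg hp.le hP0)
    linarith
  have h5 : (p + 1 : ℝ) ^ 2 * P ≤ (p + 1) ^ 2 * (8 * weightAbove k F) := by linarith
  exact le_of_mul_le_mul_left h5 (by positivity)

theorem weightAbove_majority_ge {n k : ℕ} (hn : Odd n) (hk : 4 * k ≤ n) :
    1 / (128 * √(n : ℝ)) ≤ weightAbove k (toReal (majority n)) := by
  obtain ⟨p, rfl⟩ := hn
  have h1 := (le_mean_middle p).trans (mean_middle_le_weightAbove (p := p) (k := k) (by omega))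
  rw [weightAbove_signFn] at h1
  have h2 : 1 / (128 * √((2 * p + 1 : ℕ) : ℝ)) = 1 / 32 * (1 / (4 * √((2 * p + 1 : ℕ) : ℝ))) := by
    ring
  linarith

end QAC

/-! ### Assembly of the three bounds -/

theorem mainTheorem5 :
    (∃ C : ℝ, 0 < C ∧ ∃ γ : ℕ, ∃ K : ℝ, 0 < K ∧
      ∀ (d n a : ℕ) (hn : 0 < n) (U : QAC.Circuit (n + a) d) (φ : QAC.Op a),
        QAC.IsDensityOperator φ →
        ∀ (f : QAC.Bits n → Bool) (k : ℕ),
          C * ((n : ℝ) + a) ^ (1 - 1 / (3 : ℝ) ^ d) * Real.log ((n : ℝ) + a + 1) ^ γ ≤ (k : ℝ) →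
          QAC.successProb hn U φ f ≤
            1 / 2 + 1 / 2 * √(1 - 4 * QAC.weightAbove k (QAC.toReal f)) + K * (d / n)) ∧
    (∃ K : ℝ, 0 < K ∧ ∀ (d : ℕ) (B : ℝ) (β : ℕ), ∃ n₀ : ℕ,
      ∀ (n a : ℕ) (hn : 0 < n), n₀ ≤ n →
        (a : ℝ) ≤ B * (n : ℝ) ^ (1 + 1 / (3 : ℝ) ^ d) * Real.log n ^ β →
        ∀ (U : QAC.Circuit (n + a) d) (φ : QAC.Op a), QAC.IsDensityOperator φ →
          QAC.successProb hn U φ (QAC.parity n) ≤ 1 / 2 + K * (d / n)) ∧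
    (∃ κ : ℝ, 0 < κ ∧ ∃ K : ℝ, 0 < K ∧ ∀ (d : ℕ) (B : ℝ) (β : ℕ), ∃ n₀ : ℕ,
      ∀ (n a : ℕ) (hn : 0 < n), n₀ ≤ n → Odd n →
        (a : ℝ) ≤ B * (n : ℝ) ^ (1 + 1 / (3 : ℝ) ^ d) * Real.log n ^ β →
        ∀ (U : QAC.Circuit (n + a) d) (φ : QAC.Op a), QAC.IsDensityOperator φ →
          QAC.successProb hn U φ (QAC.majority n) ≤ 1 - κ / √(n : ℝ) + K * (d / n)) := by
  refine ⟨⟨324, by norm_num, 2, 4, by norm_num, fun d n a hn U φ hφ f k hk =>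
    QAC.successProb_le_of_circuitDegree_le hn U hφ f ((QAC.circuitDegree_le hn d).trans hk)⟩,
    ⟨4, by norm_num, fun d B β => ?_⟩, ⟨1 / 128, by norm_num, 4, by norm_num, fun d B β => ?_⟩⟩
  · obtain ⟨n₀, hn₀⟩ := QAC.exists_circuitDegree_le d B β (c := 1 / 2) (by norm_num)
    -- For n ≥ 2 the degree bound n/2 is at most n − 1, the largest k that leaves level n above it.
    refine ⟨max n₀ 2, fun n a hn hle ha U φ hφ => ?_⟩
    have h2 : 2 ≤ n := (le_max_right _ _).trans hle
    have hdeg := hn₀ n a ((le_max_left _ _).trans hle) ha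
    have hk : QAC.circuitDegree (n + a) d ≤ (n - 1 : ℕ) := by
      refine hdeg.trans ?_
      rw [Nat.cast_sub hn, Nat.cast_one]
      have : (2 : ℝ) ≤ n := by exact_mod_cast h2
      linarith
    have h := QAC.successProb_le_of_circuitDegree_le hn U hφ (QAC.parity n) hk
    have hW := QAC.one_le_four_mul_weightAbove_parity (n := n) (k := n - 1) (by omega)
    rwa [Real.sqrt_eq_zero_of_nonpos (by linarith), mul_zero, add_zero] at h
  · obtain ⟨n₀, hn₀⟩ := QAC.exists_circuitDegree_le d B β (c := 1 / 8) (by norm_num)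
    refine ⟨max n₀ 8, fun n a hn hle hodd ha U φ hφ => ?_⟩
    have h8 : 8 ≤ n := (le_max_right _ _).trans hle
    have hdeg := hn₀ n a ((le_max_left _ _).trans hle) ha
    have hk : QAC.circuitDegree (n + a) d ≤ (n / 4 : ℕ) := by
      refine hdeg.trans ?_
      -- Degree n/8 leaves room for the rounding in k = ⌊n/4⌋.
      have : (n : ℝ) ≤ 8 * (n / 4 : ℕ) := by exact_mod_cast (by omega : n ≤ 8 * (n / 4))
      linarith
    have h := QAC.successProb_le_of_circuitDegree_le hn U hφ (QAC.majority n) hk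
    have hW := QAC.weightAbove_majority_ge (n := n) (k := n / 4) hodd (by omega)
    set W := QAC.weightAbove (n / 4) (QAC.toReal (QAC.majority n))
    have hW1 : 4 * W ≤ 1 := QAC.four_mul_weightAbove_le_one _ _
    -- Half of this plus 1/2 is 1 − W, so the lower bound on W becomes the loss κ/√n.
    have hsqrt : √(1 - 4 * W) ≤ 1 - 2 * W :=
      Real.sqrt_le_iff.2 ⟨by linarith, by nlinarith [sq_nonneg W]⟩
    have hκ : 1 / 128 / √(n : ℝ) = 1 / (128 * √(n : ℝ)) := by rw [div_div]
    rw [hκ]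
    linarith
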